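/- Call a measurable symmetric function $W:[0,1]^2\to[0,1]$ a graphon, let $d_W(x)=\int_0^1 W(x,y)\,dy$ be its degree function, and let $K_W(x,y)=W(x,y)/d_W(x)$ if $d_W(x)>0$ and $K_W(x,y)=0$ otherwise be its random walk kernel. If $K_W$ is square-integrable, let $\mathcal K_W:L^2([0,1])\to L^2([0,1])$, $(\mathcal K_Wf)(x)=\int_0^1K_W(x,y)f(y)\,dy$, be the random walk kernel operator on the real Hilbert space $L^2([0,1])$, and $\mathcal L_W=I-\mathcal K_W$ the random walk Laplacian. Let $$\delta_\square(U,W)=\inf_{\varphi}\ \sup_{f,g}\left|\int_{[0,1]^2}\bigl(U(x,y)-W(\varphi(x),\varphi(y))\bigr)f(x)g(y)\,dx\,dy\right|$$ be the cut distance, where $\varphi$ runs over the measure preserving maps $[0,1]\to[0,1]$ and $f,g$ over the measurable functions $[0,1]\to[0,1]$. Theorem. Let $(W_n)_n$ be a sequence of graphons and $W$ a graphon with $\delta_\square(W_n,W)\to0$, and assume that there is $\varepsilon>0$ such that, for every $n$, $d_{W_n}>\varepsilon$ almost everywhere. Then all the kernels $K_{W_n}$ and $K_W$ are square-integrable, and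 the spectra of $\mathcal K_{W_n}$ and of $\mathcal L_{W_n}$ converge pointwise to the spectra of $\mathcal K_W$ and of $\mathcal L_W$, respectively. Here pointwise convergence means the following, with $c=0$ for the operators $\mathcal K$ and $c=1$ for the operators $\mathcal L$. The spectrum of each of the operators $T$ consists of $c$ and of eigenvalues different from $c$, which have finite multiplicity and can accumulate only at $c$. Write $\lambda_1(T)\ge\lambda_2(T)\ge\dots$ for the eigenvalues greater than $c$ and $\lambda_1'(T)\le\lambda_2'(T)\le\dots$ for the eigenvalues less than $c$, repeated according to multiplicity, each list being continued by the value $c$ if it is finite. Then, for every $i\ge1$, as $n\to\infty$, $$\lambda_i(\mathcal K_{W_n})\to\lambda_i(\mathcal K_W),\quad \lambda_i'(\mathcal K_{W_n})\to\lambda_i'(\mathcal K_W),\quad \lambda_i(\mathcal L_{W_n})\to\lambda_i(\mathcal L_W),\quad \lambda_i'(\mathcal L_{W_n})\to\lambda_i'(\mathcal L_W).$$ -/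

import Mathlib

open MeasureTheory Filter Topology
open scoped unitInterval ENNReal

noncomputable section

namespace GraphonSpectra

/-- A graphon: a symmetric measurable function `[0,1]² → [0,1]`. -/
structure Graphon where
  toFun : I × I → ℝ
  measurable_toFun : Measurable toFun
  symm : ∀ x y, toFun (x, y) = toFun (y, x)
  mem_Icc : ∀ z, toFun z ∈ Set.Icc (0 : ℝ) 1

/-- The cut norm `sup_{f,g} |∫ U(x,y) f(x) g(y) dx dy|` of a bounded measurable function `U` on
`[0,1]²`, the supremum running over measurable `f, g : [0,1] → [0,1]`. -/
def cutNorm (U : I × I → ℝ) : ℝ :=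
  ⨆ p : {p : (I → I) × (I → I) // Measurable p.1 ∧ Measurable p.2},
    |∫ z : I × I, U z * (p.1.1 z.1 : ℝ) * (p.1.2 z.2 : ℝ)|

/-- The cut distance `inf_φ ‖U - W^φ‖_□`, where `W^φ(x,y) = W(φ(x),φ(y))` and `φ` runs over the
measure preserving maps `[0,1] → [0,1]`. -/
def cutDist (U W : Graphon) : ℝ :=
  ⨅ φ : {φ : I → I // MeasurePreserving φ volume volume},
    cutNorm (fun z => U.toFun z - W.toFun (φ.1 z.1, φ.1 z.2))

/-- The degree function `d_W(x) = ∫ W(x,y) dy`. -/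
def Graphon.degree (W : Graphon) (x : I) : ℝ := ∫ y : I, W.toFun (x, y)

open Classical in
/-- The random walk kernel `K_W(x,y) = W(x,y) / d_W(x)` if `d_W(x) > 0`, and `0` otherwise. -/
def Graphon.rwKernel (W : Graphon) (z : I × I) : ℝ :=
  if 0 < W.degree z.1 then W.toFun z / W.degree z.1 else 0

/-! ### The operator induced by a square-integrable kernel -/

/-- The real Hilbert space `L²([0,1])`. -/
abbrev L2 := Lp ℝ 2 (volume : Measure I)

theorem sq_rpow (a : ℝ≥0∞) : (a ^ (1 / 2 : ℝ)) ^ 2 = a := by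
  rw [← ENNReal.rpow_natCast, ← ENNReal.rpow_mul]; norm_num

theorem eLpNorm_two_sq {α : Type*} [MeasurableSpace α] (μ : Measure α) (f : α → ℝ) :
    eLpNorm f 2 μ ^ 2 = ∫⁻ x, ‖f x‖ₑ ^ 2 ∂μ := by
  rw [eLpNorm_eq_lintegral_rpow_enorm_toReal two_ne_zero ENNReal.ofNat_ne_top,
    ENNReal.toReal_ofNat, sq_rpow]
  simp only [ENNReal.rpow_ofNat]

theorem lintegral_mul_sq_le {f g : I → ℝ} (hf : AEMeasurable f) (hg : AEMeasurable g) :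
    (∫⁻ y, ‖f y * g y‖ₑ) ^ 2 ≤ (∫⁻ y, ‖f y‖ₑ ^ 2) * ∫⁻ y, ‖g y‖ₑ ^ 2 := by
  have h := ENNReal.lintegral_mul_le_Lp_mul_Lq (volume : Measure I)
    (Real.HolderConjugate.two_two) hf.enorm hg.enorm
  have h2 := pow_le_pow_left' h 2
  rw [mul_pow, sq_rpow, sq_rpow] at h2
  simpa [enorm_mul] using h2

variable {K : I × I → ℝ}

theorem ae_slice (hK : MemLp K 2) :
    ∀ᵐ x : I, AEStronglyMeasurable (fun y => K (x, y)) ∧ (∫⁻ y, ‖K (x, y)‖ₑ ^ 2) < ∞ := by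
  have h1 : ∀ᵐ x : I, AEStronglyMeasurable (fun y => K (x, y)) := hK.1.prodMk_left
  have hm : AEMeasurable (fun z => ‖K z‖ₑ ^ 2) ((volume : Measure I).prod volume) :=
    hK.1.aemeasurable.enorm.pow_const 2
  have h2 : ∀ᵐ x : I, (∫⁻ y, ‖K (x, y)‖ₑ ^ 2) < ∞ := by
    refine ae_lt_top' hm.lintegral_prod_right' ?_
    rw [← lintegral_prod _ hm]
    have := eLpNorm_two_sq volume K
    rw [Measure.volume_eq_prod] at this
    rw [← this]
    exact (ENNReal.pow_lt_top hK.2).ne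
  filter_upwards [h1, h2] with x a b using ⟨a, b⟩

theorem ae_integrable (hK : MemLp K 2) (f : L2) :
    ∀ᵐ x : I, Integrable (fun y => K (x, y) * f y) := by
  have hf := Lp.memLp f
  filter_upwards [ae_slice hK] with x hx
  refine ⟨hx.1.mul hf.1, ?_⟩
  have h := lintegral_mul_sq_le hx.1.aemeasurable hf.1.aemeasurable
  rw [← eLpNorm_two_sq volume f] at h
  have h3 : (∫⁻ y, ‖K (x, y) * f y‖ₑ) ^ 2 < ∞ :=
    h.trans_lt (ENNReal.mul_lt_top hx.2 (ENNReal.pow_lt_top hf.2))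
  exact (ENNReal.pow_lt_top_iff.1 h3).resolve_right (by norm_num)

theorem eLpNorm_integral_le (hK : MemLp K 2) (f : L2) :
    eLpNorm (fun x : I => ∫ y : I, K (x, y) * f y) 2 ≤ eLpNorm K 2 * eLpNorm f 2 := by
  have hf := Lp.memLp f
  refine (ENNReal.pow_le_pow_left_iff two_ne_zero).1 ?_
  have hm : AEMeasurable (fun z => ‖K z‖ₑ ^ 2) ((volume : Measure I).prod volume) :=
    hK.1.aemeasurable.enorm.pow_const 2
  rw [mul_pow, eLpNorm_two_sq, eLpNorm_two_sq volume K, Measure.volume_eq_prod,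
    lintegral_prod _ hm, ← lintegral_mul_const'' _ hm.lintegral_prod_right']
  refine lintegral_mono_ae ?_
  filter_upwards [ae_slice hK] with x hx
  have h := lintegral_mul_sq_le hx.1.aemeasurable hf.1.aemeasurable
  rw [eLpNorm_two_sq]
  exact (pow_le_pow_left' (enorm_integral_le_lintegral_enorm _) 2).trans h

theorem memLp_integral (hK : MemLp K 2) (f : L2) :
    MemLp (fun x : I => ∫ y : I, K (x, y) * f y) 2 := by
  refine ⟨?_, (eLpNorm_integral_le hK f).trans_lt (ENNReal.mul_lt_top hK.2 (Lp.memLp f).2)⟩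
  have h : AEStronglyMeasurable (fun z : I × I => K z * f z.2) ((volume : Measure I).prod volume) :=
    hK.1.mul (Lp.memLp f).1.comp_snd
  exact h.integral_prod_right'

/-- The bounded operator `f ↦ ∫ K(·,y) f(y) dy` on `L²([0,1])` induced by a square-integrable
kernel `K`. -/
def kernelOp (hK : MemLp K 2) : L2 →L[ℝ] L2 :=
  LinearMap.mkContinuous
    { toFun := fun f => (memLp_integral hK f).toLp (fun x : I => ∫ y : I, K (x, y) * f y)
      map_add' := fun f g => by
        rw [← MemLp.toLp_add, MemLp.toLp_eq_toLp_iff]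
        filter_upwards [ae_integrable hK f, ae_integrable hK g] with x hf hg
        rw [Pi.add_apply, ← integral_add hf hg]
        refine integral_congr_ae ?_
        filter_upwards [Lp.coeFn_add f g] with y hy
        rw [hy, Pi.add_apply, mul_add]
      map_smul' := fun c f => by
        rw [RingHom.id_apply, ← MemLp.toLp_const_smul, MemLp.toLp_eq_toLp_iff]
        filter_upwards with x
        rw [Pi.smul_apply, smul_eq_mul, ← integral_const_mul]
        refine integral_congr_ae ?_
        filter_upwards [Lp.coeFn_smul c f] with y hy
        rw [hy, Pi.smul_apply, smul_eq_mul, mul_left_comm] }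
    (eLpNorm K 2).toReal (fun f => by
      change ‖(memLp_integral hK f).toLp _‖ ≤ _
      rw [Lp.norm_toLp, Lp.norm_def, ← ENNReal.toReal_mul]
      exact ENNReal.toReal_mono (ENNReal.mul_lt_top hK.2 (Lp.memLp f).2).ne
        (eLpNorm_integral_le hK f))

theorem kernelOp_apply (hK : MemLp K 2) (f : L2) :
    kernelOp hK f =ᵐ[volume] fun x : I => ∫ y : I, K (x, y) * f y :=
  MemLp.coeFn_toLp (memLp_integral hK f)

/-- The random walk kernel operator of a graphon whose random walk kernel is square-integrable. -/
def Graphon.rwOp (W : Graphon) (hW : MemLp W.rwKernel 2) : L2 →L[ℝ] L2 := kernelOp hW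

/-- The random walk Laplacian operator `f ↦ f - K_W f`. -/
def Graphon.rwLaplacian (W : Graphon) (hW : MemLp W.rwKernel 2) : L2 →L[ℝ] L2 :=
  ContinuousLinearMap.id ℝ L2 - W.rwOp hW

/-! ### Pointwise convergence of spectra -/

/-- The spectrum of `T` is discrete away from its only possible accumulation point `c`, and
* `a 0 ≥ a 1 ≥ …` lists the eigenvalues of `T` above `c` in decreasing order,
* `b 0 ≤ b 1 ≤ …` lists the eigenvalues of `T` below `c` in increasing order,

each eigenvalue repeated according to its (finite) multiplicity, and each list continued by the
constant value `c` if it is finite. These conditions determine `a` and `b`. -/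
structure IsSpectralListing (T : L2 →L[ℝ] L2) (c : ℝ) (a b : ℕ → ℝ) : Prop where
  antitone_above : Antitone a
  monotone_below : Monotone b
  le_above : ∀ i, c ≤ a i
  below_le : ∀ i, b i ≤ c
  tendsto_above : Tendsto a atTop (𝓝 c)
  tendsto_below : Tendsto b atTop (𝓝 c)
  spectrum_eq : spectrum ℝ T = insert c (Set.range a ∪ Set.range b)
  finite_multiplicity : ∀ μ, μ ≠ c →
    FiniteDimensional ℝ (Module.End.eigenspace (T : Module.End ℝ L2) μ)
  multiplicity_above : ∀ μ, c < μ → {i | a i = μ}.encard =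
    (Module.finrank ℝ (Module.End.eigenspace (T : Module.End ℝ L2) μ) : ℕ∞)
  multiplicity_below : ∀ μ, μ < c → {i | b i = μ}.encard =
    (Module.finrank ℝ (Module.End.eigenspace (T : Module.End ℝ L2) μ) : ℕ∞)

/-- Pointwise convergence of the spectra of `T n` to the spectrum of `S`, all of them discrete away
from `c`: for every `i` the `i`-th largest eigenvalue above `c` converges, and so does the `i`-th
smallest eigenvalue below `c` (with multiplicity, continued by `c`). -/
def SpectraConvergePointwise (T : ℕ → L2 →L[ℝ] L2) (S : L2 →L[ℝ] L2) (c : ℝ) : Prop :=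
  ∃ (an bn : ℕ → ℕ → ℝ) (a b : ℕ → ℝ),
    (∀ n, IsSpectralListing (T n) c (an n) (bn n)) ∧ IsSpectralListing S c a b ∧
    (∀ i, Tendsto (fun n => an n i) atTop (𝓝 (a i))) ∧
    (∀ i, Tendsto (fun n => bn n i) atTop (𝓝 (b i)))

end GraphonSpectra

end

/-! The random walk operator is not self-adjoint on `L²`, but when the degrees are at least `ε`,
multiplication by `√d` is an automorphism of `L²` that conjugates it to the operator with symmetric
kernel `W(x,y)/√(d(x)d(y))` (`exists_equiv_rwOp`). The latter is Hilbert–Schmidt, hence compact and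
self-adjoint, and its positive eigenvalues are the min-max values `posEigen`; the negative ones come
from `-T` (`isSpectralListing_posEigen`). These values are 1-Lipschitz in the operator norm
(`abs_posEigen_sub_le`).

It remains to pass from the cut distance to the operator norm. Relabelling by a measure preserving
`φ` turns `T` into `J T J*` with `J f = f ∘ φ` an isometry, and this leaves the min-max values
unchanged even if `φ` is not invertible (`kernelOp_comp_comp`, `posEigen_conj_isometry`). If `U -
W^φ` is small in cut norm, the degrees are close in `L¹` (`integral_abs_degree_sub_le`). As `t ↦
1/√(max t ε)` is bounded and Lipschitz, the symmetrized kernels are then close against bounded test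
functions (`abs_integral_symKernel_sub_le`). These kernels are uniformly bounded, so truncating `L²`
functions upgrades this to closeness in operator norm (`norm_kernelOp_le_of_bounded`).

The `L¹` closeness of degrees also transfers the bound `ε` to the limit graphon. The Laplacian
statement follows from `λ ↦ 1 - λ`, which exchanges the two lists. -/

noncomputable section

namespace GraphonSpectra

/-! ### Min-max values of bounded operators on a real Hilbert space -/

section MinMax

variable {H : Type*} [NormedAddCommGroup H] [InnerProductSpace ℝ H]

open Module Module.End

/-- The levels `t ≥ 0` such that `t = 0` or the quadratic form of `T` is at least `t ‖v‖²` on some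
subspace of dimension `i + 1`. -/
def minMaxLevels (T : H →L[ℝ] H) (i : ℕ) : Set ℝ :=
  {t | 0 ≤ t ∧ (t = 0 ∨ ∃ V : Submodule ℝ H, finrank ℝ V = i + 1 ∧
    ∀ v ∈ V, t * ‖v‖ ^ 2 ≤ inner ℝ (T v) v)}

/-- The `i`-th largest positive eigenvalue of a compact self-adjoint operator, described by the
min-max principle, and `0` if there are at most `i` of them. -/
def posEigen (T : H →L[ℝ] H) (i : ℕ) : ℝ := sSup (minMaxLevels T i)

theorem zero_mem_minMaxLevels (T : H →L[ℝ] H) (i : ℕ) : 0 ∈ minMaxLevels T i :=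
  ⟨le_rfl, Or.inl rfl⟩

theorem inner_apply_self_le (T : H →L[ℝ] H) (v : H) : inner ℝ (T v) v ≤ ‖T‖ * ‖v‖ ^ 2 := by
  have h1 := real_inner_le_norm (T v) v
  have h2 := mul_le_mul_of_nonneg_right (T.le_opNorm v) (norm_nonneg v)
  nlinarith

theorem exists_ne_zero_mem_of_finrank {V : Submodule ℝ H} {i : ℕ} (hV : finrank ℝ V = i + 1) :
    ∃ v ∈ V, v ≠ 0 := by
  have : V ≠ ⊥ := by
    rintro rfl
    simp at hV
  exact V.exists_mem_ne_zero_of_ne_bot this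

theorem bddAbove_minMaxLevels (T : H →L[ℝ] H) (i : ℕ) : BddAbove (minMaxLevels T i) := by
  refine ⟨‖T‖, ?_⟩
  rintro t ⟨-, rfl | ⟨V, hV, h⟩⟩
  · exact norm_nonneg T
  · obtain ⟨v, hv, hv0⟩ := exists_ne_zero_mem_of_finrank hV
    have hpos : 0 < ‖v‖ ^ 2 := by positivity
    exact le_of_mul_le_mul_right ((h v hv).trans (inner_apply_self_le T v)) hpos

theorem posEigen_nonneg (T : H →L[ℝ] H) (i : ℕ) : 0 ≤ posEigen T i :=
  le_csSup (bddAbove_minMaxLevels T i) (zero_mem_minMaxLevels T i)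

theorem le_posEigen {T : H →L[ℝ] H} {i : ℕ} {t : ℝ} {V : Submodule ℝ H} (hV : finrank ℝ V = i + 1)
    (h : ∀ v ∈ V, t * ‖v‖ ^ 2 ≤ inner ℝ (T v) v) : t ≤ posEigen T i := by
  rcases le_total t 0 with ht | ht
  · exact ht.trans (posEigen_nonneg T i)
  · exact le_csSup (bddAbove_minMaxLevels T i) ⟨ht, Or.inr ⟨V, hV, h⟩⟩

theorem posEigen_le {T : H →L[ℝ] H} {i : ℕ} {s : ℝ} (hs : 0 ≤ s)
    (h : ∀ t > 0, ∀ V : Submodule ℝ H, finrank ℝ V = i + 1 →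
      (∀ v ∈ V, t * ‖v‖ ^ 2 ≤ inner ℝ (T v) v) → t ≤ s) : posEigen T i ≤ s := by
  refine csSup_le ⟨0, zero_mem_minMaxLevels T i⟩ ?_
  rintro t ⟨ht, rfl | ⟨V, hV, hVt⟩⟩
  · exact hs
  · rcases ht.eq_or_lt with rfl | ht
    · exact hs
    · exact h t ht V hV hVt

theorem exists_submodule_le_finrank_eq {V : Submodule ℝ H} {k : ℕ} (hk : k ≤ finrank ℝ V) :
    ∃ U ≤ V, finrank ℝ U = k := by
  obtain ⟨f, hf⟩ := exists_linearIndependent_of_le_finrank hk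
  have hf' := hf.map' V.subtype V.ker_subtype
  refine ⟨Submodule.span ℝ (Set.range (V.subtype ∘ f)), ?_, ?_⟩
  · rw [Submodule.span_le]
    rintro _ ⟨j, rfl⟩
    exact (f j).2
  · rw [finrank_span_eq_card hf', Fintype.card_fin]

theorem antitone_posEigen (T : H →L[ℝ] H) : Antitone (posEigen T) := by
  refine antitone_nat_of_succ_le fun i => posEigen_le (posEigen_nonneg T i) ?_
  intro t _ V hV h
  obtain ⟨U, hUV, hU⟩ := exists_submodule_le_finrank_eq (V := V) (k := i + 1) (by omega)
  exact le_posEigen hU fun v hv => h v (hUV hv)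

theorem posEigen_le_add_norm_sub (A B : H →L[ℝ] H) (i : ℕ) :
    posEigen A i ≤ posEigen B i + ‖A - B‖ := by
  refine posEigen_le (add_nonneg (posEigen_nonneg B i) (norm_nonneg _)) fun t _ V hV h => ?_
  rw [← sub_le_iff_le_add]
  refine le_posEigen hV fun v hv => ?_
  have h1 := h v hv
  have h2 := inner_apply_self_le (A - B) v
  rw [sub_apply, inner_sub_left] at h2
  linarith

/-- Weyl's inequality. -/
theorem abs_posEigen_sub_le (A B : H →L[ℝ] H) (i : ℕ) :
    |posEigen A i - posEigen B i| ≤ ‖A - B‖ := by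
  rw [abs_sub_le_iff]
  have h1 := posEigen_le_add_norm_sub A B i
  have h2 := posEigen_le_add_norm_sub B A i
  rw [norm_sub_rev] at h2
  constructor <;> linarith

/-- With `J` the isometry, the form of `J S J*` at `v` is the form of `S` at `J* v`. So `J*` carries
test spaces of `J S J*` to test spaces of `S`, being a contraction, and `J` carries them back since
`J* J = 1`. Surjectivity of `J` is not needed because only levels `t > 0` matter. -/
theorem posEigen_conj_isometry [CompleteSpace H] (C : H →ₗᵢ[ℝ] H) (S : H →L[ℝ] H) (i : ℕ) :
    posEigen (C.toContinuousLinearMap ∘L S ∘L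
      ContinuousLinearMap.adjoint C.toContinuousLinearMap) i = posEigen S i := by
  set J := C.toContinuousLinearMap
  have hJ (v : H) : inner ℝ ((J ∘L S ∘L ContinuousLinearMap.adjoint J) v) v =
      inner ℝ (S (ContinuousLinearMap.adjoint J v)) (ContinuousLinearMap.adjoint J v) := by
    simp [ContinuousLinearMap.adjoint_inner_right]
  have hJJ (v : H) : ContinuousLinearMap.adjoint J (J v) = v := by
    refine ext_inner_right ℝ fun w => ?_
    rw [ContinuousLinearMap.adjoint_inner_left]
    exact C.inner_map_map v w
  have hJn (v : H) : ‖ContinuousLinearMap.adjoint J v‖ ≤ ‖v‖ := by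
    refine (ContinuousLinearMap.le_opNorm _ v).trans ?_
    rw [LinearIsometryEquiv.norm_map]
    exact mul_le_of_le_one_left (norm_nonneg v) C.norm_toContinuousLinearMap_le
  refine le_antisymm ?_ ?_
  · refine posEigen_le (posEigen_nonneg S i) fun t ht V hV h => ?_
    -- On the kernel of `J*` the form vanishes, so `t > 0` makes `V` meet it trivially.
    have hinj : Function.Injective
        ((ContinuousLinearMap.adjoint J : H →L[ℝ] H).toLinearMap.domRestrict V) := by
      rw [← LinearMap.ker_eq_bot, LinearMap.ker_eq_bot']
      rintro ⟨v, hv⟩ hv0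
      have hv0' : ContinuousLinearMap.adjoint J v = 0 := hv0
      have h1 := h v hv
      rw [hJ, hv0', inner_zero_right] at h1
      have h2 : ‖v‖ ^ 2 = 0 := by nlinarith [sq_nonneg ‖v‖]
      ext
      simpa using h2
    refine le_posEigen (V := V.map (ContinuousLinearMap.adjoint J : H →L[ℝ] H).toLinearMap) ?_ ?_
    · rw [← hV, ← LinearMap.range_domRestrict, LinearMap.finrank_range_of_inj hinj]
    · rintro _ ⟨v, hv, rfl⟩
      have h1 := h v hv
      rw [hJ] at h1
      refine le_trans ?_ h1
      have := hJn v
      have h3 : ‖ContinuousLinearMap.adjoint J v‖ ^ 2 ≤ ‖v‖ ^ 2 :=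
        pow_le_pow_left₀ (norm_nonneg _) this 2
      exact mul_le_mul_of_nonneg_left h3 ht.le
  · refine posEigen_le (posEigen_nonneg _ i) fun t ht V hV h => ?_
    refine le_posEigen (V := V.map C.toLinearMap) ?_ ?_
    · rw [← hV, ← LinearMap.range_domRestrict]
      exact LinearMap.finrank_range_of_inj (C.injective.comp Subtype.val_injective)
    · rintro _ ⟨v, hv, rfl⟩
      change t * ‖C v‖ ^ 2 ≤ inner ℝ _ (J v)
      change _ ≤ inner ℝ ((J ∘L S ∘L ContinuousLinearMap.adjoint J) (J v)) (J v)
      rw [hJ, hJJ, C.norm_map]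
      exact h v hv

/-! ### Spectral subspaces of compact self-adjoint operators -/

/-- The span of the eigenspaces of `T` with eigenvalues in `s`. -/
def spectralSpan (T : H →L[ℝ] H) (s : Set ℝ) : Submodule ℝ H :=
  ⨆ ν : s, eigenspace (T : End ℝ H) ν

/-- Pythagoras: `v` is a finite sum of mutually orthogonal eigenvectors, and `q ν` is the squared
norm of the component at `ν`. -/
theorem spectralSpan_decomp {T : H →L[ℝ] H} (hT : T.IsSymmetric) {s : Set ℝ} {v : H}
    (hv : v ∈ spectralSpan T s) : ∃ (u : Finset s) (q : s → ℝ), (∀ ν, 0 ≤ q ν) ∧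
      ‖v‖ ^ 2 = ∑ ν ∈ u, q ν ∧ inner ℝ (T v) v = ∑ ν ∈ u, (ν : ℝ) * q ν := by
  obtain ⟨f, hf, rfl⟩ := (Submodule.mem_iSup_iff_exists_finsupp _ _).1 hv
  have hO := (hT.orthogonalFamily_eigenspaces).comp (Subtype.val_injective (p := (· ∈ s)))
  let l : ∀ ν : s, eigenspace (T : End ℝ H) ν := fun ν => ⟨f ν, hf ν⟩
  let l' : ∀ ν : s, eigenspace (T : End ℝ H) ν := fun ν => (ν : ℝ) • l ν
  have hT' (ν : s) : T (f ν) = (ν : ℝ) • f ν := mem_eigenspace_iff.1 (hf ν)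
  refine ⟨f.support, fun ν => ‖f ν‖ ^ 2, fun ν => sq_nonneg _, hO.norm_sum l f.support, ?_⟩
  have h := hO.inner_sum l' l f.support
  have h1 : T (f.sum fun _ x => x) = ∑ ν ∈ f.support, (ν : ℝ) • f ν := by
    simp [Finsupp.sum, map_sum, hT']
  rw [h1]
  refine h.trans (Finset.sum_congr rfl fun ν _ => ?_)
  change inner ℝ ((ν : ℝ) • f ν) (f ν) = _
  rw [real_inner_smul_left, real_inner_self_eq_norm_sq]

theorem le_inner_of_mem_spectralSpan {T : H →L[ℝ] H} (hT : T.IsSymmetric) {s : Set ℝ} {t : ℝ}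
    (hs : ∀ ν ∈ s, t ≤ ν) {v : H} (hv : v ∈ spectralSpan T s) :
    t * ‖v‖ ^ 2 ≤ inner ℝ (T v) v := by
  obtain ⟨u, q, hq, h1, h2⟩ := spectralSpan_decomp hT hv
  rw [h1, h2, Finset.mul_sum]
  exact Finset.sum_le_sum fun ν _ => mul_le_mul_of_nonneg_right (hs ν ν.2) (hq ν)

theorem inner_le_of_mem_spectralSpan {T : H →L[ℝ] H} (hT : T.IsSymmetric) {s : Set ℝ} {t : ℝ}
    (hs : ∀ ν ∈ s, ν ≤ t) {v : H} (hv : v ∈ spectralSpan T s) :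
    inner ℝ (T v) v ≤ t * ‖v‖ ^ 2 := by
  obtain ⟨u, q, hq, h1, h2⟩ := spectralSpan_decomp hT hv
  rw [h1, h2, Finset.mul_sum]
  exact Finset.sum_le_sum fun ν _ => mul_le_mul_of_nonneg_right (hs ν ν.2) (hq ν)

/-- By Cauchy–Schwarz `T` is bounded below on the closure of `V`, so it is a closed embedding there.
Compactness of `T` then makes the identity of that closure compact, and Riesz's theorem applies. -/
theorem finiteDimensional_of_le_inner [CompleteSpace H] {T : H →L[ℝ] H} (hT : IsCompactOperator T)
    {V : Submodule ℝ H} {t : ℝ} (ht : 0 < t) (hV : ∀ v ∈ V, t * ‖v‖ ^ 2 ≤ inner ℝ (T v) v) :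
    FiniteDimensional ℝ V := by
  set K := V.topologicalClosure
  have hK : ∀ v ∈ K, t * ‖v‖ ^ 2 ≤ inner ℝ (T v) v := by
    have hcl : IsClosed {v : H | t * ‖v‖ ^ 2 ≤ inner ℝ (T v) v} :=
      isClosed_le (by fun_prop) (by fun_prop)
    intro v hv
    exact closure_minimal (s := (V : Set H)) hV hcl hv
  have hc : CompleteSpace K := V.isClosed_topologicalClosure.completeSpace_coe
  let f : K →L[ℝ] H := T ∘L K.subtypeL
  have hf : ∀ v : K, t * ‖v‖ ≤ ‖f v‖ := by
    rintro ⟨v, hv⟩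
    change t * ‖v‖ ≤ ‖T v‖
    have h1 := (hK v hv).trans (real_inner_le_norm (T v) v)
    rcases (norm_nonneg v).eq_or_lt with h0 | h0
    · rw [← h0]; simp
    · exact le_of_mul_le_mul_right (by linarith [h1]) h0
  have hanti : ∃ C, AntilipschitzWith C f :=
    antilipschitzWith_iff_exists_mul_le_norm.2 ⟨t, ht, hf⟩
  obtain ⟨C, hC⟩ := hanti
  have hemb := hC.isClosedEmbedding f.uniformContinuous
  obtain ⟨A, hA, hA0⟩ := hT.comp_clm K.subtypeL
  have hid : IsCompactOperator (id : K → K) := ⟨f ⁻¹' A, hemb.isCompact_preimage hA, hA0⟩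
  have := FiniteDimensional.of_isCompactOperator_id (𝕜 := ℝ) hid
  exact Submodule.finiteDimensional_of_le V.le_topologicalClosure

theorem eigenspace_le_spectralSpan (T : H →L[ℝ] H) {s : Set ℝ} {ν : ℝ} (hν : ν ∈ s) :
    eigenspace (T : End ℝ H) ν ≤ spectralSpan T s :=
  le_iSup (fun ν : s => eigenspace (T : End ℝ H) ν) ⟨ν, hν⟩

theorem eigenspace_neg (T : H →L[ℝ] H) (μ : ℝ) :
    eigenspace ((-T : H →L[ℝ] H) : End ℝ H) (-μ) = eigenspace (T : End ℝ H) μ := by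
  ext v
  rw [mem_eigenspace_iff, mem_eigenspace_iff]
  change -T v = -μ • v ↔ T v = μ • v
  rw [neg_smul, neg_inj]

theorem le_posEigen_of_lt_finrank {T : H →L[ℝ] H} (hT : T.IsSymmetric) {t : ℝ} {i : ℕ}
    (hi : i < finrank ℝ (spectralSpan T (Set.Ici t))) : t ≤ posEigen T i := by
  obtain ⟨U, hU, hd⟩ := exists_submodule_le_finrank_eq (Nat.succ_le_of_lt hi)
  exact le_posEigen hd fun v hv => le_inner_of_mem_spectralSpan hT (fun _ h => h) (hU hv)

variable [CompleteSpace H]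

theorem finiteDimensional_spectralSpan {T : H →L[ℝ] H} (hT : T.IsSymmetric)
    (hc : IsCompactOperator T) {t : ℝ} (ht : 0 < t) :
    FiniteDimensional ℝ (spectralSpan T (Set.Ici t)) :=
  finiteDimensional_of_le_inner hc ht fun _ hv =>
    le_inner_of_mem_spectralSpan hT (fun _ h => h) hv

theorem finite_eigenvalues_ge {T : H →L[ℝ] H} (hT : T.IsSymmetric)
    (hc : IsCompactOperator T) {t : ℝ} (ht : 0 < t) :
    {ν | t ≤ ν ∧ HasEigenvalue (T : End ℝ H) ν}.Finite := by
  have := finiteDimensional_spectralSpan hT hc ht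
  choose v hv using fun ν : {ν | t ≤ ν ∧ HasEigenvalue (T : End ℝ H) ν} =>
    ν.2.2.exists_hasEigenvector
  have hli := eigenvectors_linearIndependent' (T : End ℝ H) _ Subtype.val_injective v hv
  let w (ν : {ν | t ≤ ν ∧ HasEigenvalue (T : End ℝ H) ν}) : spectralSpan T (Set.Ici t) :=
    ⟨v ν, eigenspace_le_spectralSpan T ν.2.1 (hv ν).1⟩
  have hw : LinearIndependent ℝ w := LinearIndependent.of_comp (Submodule.subtype _) hli
  have := hw.finite
  exact Set.toFinite _

/-- Positive eigenvalues of a compact self-adjoint operator are isolated. -/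
theorem exists_eigenvalue_gap {T : H →L[ℝ] H} (hT : T.IsSymmetric)
    (hc : IsCompactOperator T) {μ : ℝ} (hμ : 0 < μ) :
    ∃ δ, 0 < δ ∧ δ < μ ∧ ∀ ν, HasEigenvalue (T : End ℝ H) ν → |ν - μ| < δ → ν = μ := by
  -- Only finitely many eigenvalues exceed `μ / 2`; taking the radius at most `μ / 2` keeps all
  -- competitors in that range.
  have hfin := (finite_eigenvalues_ge hT hc (half_pos hμ)).subset (Set.sdiff_subset (t := {μ}))
  obtain ⟨δ, hδ, h⟩ := Metric.isOpen_iff.1 hfin.isClosed.isOpen_compl μ (by simp)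
  refine ⟨min δ (μ / 2), by positivity, by linarith [min_le_right δ (μ / 2)], fun ν hν h' => ?_⟩
  by_contra hne
  have h1 := abs_lt.1 (h'.trans_le (min_le_right _ _))
  exact h (Metric.mem_ball.2 ((Real.dist_eq ν μ).trans_lt (h'.trans_le (min_le_left _ _))))
    ⟨⟨by linarith, hν⟩, hne⟩

/-- By the spectral theorem the eigenspaces span a dense subspace, so a vector orthogonal to those
with eigenvalue at least `t` lies in the closure of the span of the others, where the form is at
most `s`. -/
theorem inner_le_of_mem_spectralSpan_orthogonal {T : H →L[ℝ] H} (hT : T.IsSymmetric)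
    (hc : IsCompactOperator T) {s t : ℝ} (hst : s < t)
    (hgap : ∀ ν, HasEigenvalue (T : End ℝ H) ν → ν ≤ s ∨ t ≤ ν) {v : H}
    (hv : v ∈ (spectralSpan T (Set.Ici t))ᗮ) : inner ℝ (T v) v ≤ s * ‖v‖ ^ 2 := by
  set F := spectralSpan T (Set.Ici t)
  set G := spectralSpan T (Set.Iic s)
  have hGF : G ≤ Fᗮ := by
    rw [← Submodule.isOrtho_iff_le]
    refine Submodule.isOrtho_iSup_left.2 fun ν => Submodule.isOrtho_iSup_right.2 fun ν' => ?_
    have hne : (ν : ℝ) ≠ ν' := (lt_of_le_of_lt ν.2 (hst.trans_le ν'.2)).ne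
    exact hT.orthogonalFamily_eigenspaces.isOrtho hne
  have htop : (F ⊔ G)ᗮ = ⊥ := by
    rw [eq_bot_iff, ← ContinuousLinearMap.orthogonalComplement_iSup_eigenspaces_eq_bot hc hT]
    refine Submodule.orthogonal_le (iSup_le fun ν => ?_)
    by_cases hν : HasEigenvalue (T : End ℝ H) ν
    · rcases hgap ν hν with h | h
      · exact (eigenspace_le_spectralSpan T (Set.mem_Iic.2 h)).trans le_sup_right
      · exact (eigenspace_le_spectralSpan T (Set.mem_Ici.2 h)).trans le_sup_left
    · rw [not_not.1 (fun h => hν (hasEigenvalue_iff.2 h))]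
      exact bot_le
  set K := G.topologicalClosure
  have hcs : CompleteSpace K := G.isClosed_topologicalClosure.completeSpace_coe
  have hKF : K ≤ Fᗮ := G.topologicalClosure_minimal hGF F.isClosed_orthogonal
  -- The component of `v` orthogonal to `K` is orthogonal to both `F` and `G`, hence zero.
  have hvK : v ∈ K := by
    have h1 : v - K.starProjection v ∈ Kᗮ := K.sub_starProjection_mem_orthogonal v
    have h2 : v - K.starProjection v ∈ Fᗮ :=
      sub_mem hv (hKF (K.starProjection_apply_mem v))
    have h3 : v - K.starProjection v ∈ (F ⊔ G)ᗮ := by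
      rw [← Submodule.inf_orthogonal]
      exact ⟨h2, Submodule.orthogonal_le G.le_topologicalClosure h1⟩
    rw [htop, Submodule.mem_bot, sub_eq_zero] at h3
    rw [h3]
    exact K.starProjection_apply_mem v
  have hcl : IsClosed {v : H | inner ℝ (T v) v ≤ s * ‖v‖ ^ 2} :=
    isClosed_le (by fun_prop) (by fun_prop)
  exact closure_minimal (s := (G : Set H))
    (fun w hw => inner_le_of_mem_spectralSpan hT (fun _ h => h) hw) hcl hvK

/-- Dimension count: a test space of dimension `i + 1` contains a nonzero vector orthogonal to the
spectral subspace, which has dimension at most `i`. -/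
theorem posEigen_le_of_finrank_le {T : H →L[ℝ] H} (hT : T.IsSymmetric)
    (hc : IsCompactOperator T) {s t : ℝ} (hs : 0 ≤ s) (hst : s < t)
    (hgap : ∀ ν, HasEigenvalue (T : End ℝ H) ν → ν ≤ s ∨ t ≤ ν) {i : ℕ}
    (hi : finrank ℝ (spectralSpan T (Set.Ici t)) ≤ i) : posEigen T i ≤ s := by
  refine posEigen_le hs fun r _ V hV h => ?_
  set F := spectralSpan T (Set.Ici t)
  have hF : FiniteDimensional ℝ F := finiteDimensional_spectralSpan hT hc (hs.trans_lt hst)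
  have hVf : FiniteDimensional ℝ V := FiniteDimensional.of_finrank_pos (by omega)
  let p : V →ₗ[ℝ] F := F.orthogonalProjectionOnto.toLinearMap.domRestrict V
  have hp : LinearMap.ker p ≠ ⊥ := LinearMap.ker_ne_bot_of_finrank_lt (by omega)
  obtain ⟨⟨v, hv⟩, hvp, hv0⟩ := Submodule.exists_mem_ne_zero_of_ne_bot hp
  have hvF : v ∈ Fᗮ := by
    rw [← Submodule.orthogonalProjectionOnto_eq_zero_iff]
    exact hvp
  have hv0' : v ≠ 0 := fun h0 => hv0 (Subtype.ext h0)
  have hpos : 0 < ‖v‖ ^ 2 := by positivity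
  exact le_of_mul_le_mul_right
    ((h v hv).trans (inner_le_of_mem_spectralSpan_orthogonal hT hc hst hgap hvF)) hpos

theorem finrank_spectralSpan_Ici {T : H →L[ℝ] H} (hT : T.IsSymmetric)
    (hc : IsCompactOperator T) {μ δ : ℝ} (hμ : 0 < μ) (hδ : 0 < δ)
    (hgap : ∀ ν, HasEigenvalue (T : End ℝ H) ν → |ν - μ| < δ → ν = μ) :
    finrank ℝ (spectralSpan T (Set.Ici μ)) =
      finrank ℝ (spectralSpan T (Set.Ici (μ + δ))) + finrank ℝ (eigenspace (T : End ℝ H) μ) := by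
  have h1 := finiteDimensional_spectralSpan hT hc (add_pos hμ hδ)
  have h2 := ContinuousLinearMap.finite_dimensional_eigenspace hc μ hμ.ne'
  have hsup : spectralSpan T (Set.Ici μ) =
      spectralSpan T (Set.Ici (μ + δ)) ⊔ eigenspace (T : End ℝ H) μ := by
    refine le_antisymm (iSup_le fun ν => ?_) (sup_le (iSup_le fun ν => ?_) ?_)
    · by_cases hν : HasEigenvalue (T : End ℝ H) ν
      · rcases lt_or_ge (ν : ℝ) (μ + δ) with h | h
        · have hle : μ ≤ ν := ν.2
          rw [hgap ν hν (abs_lt.2 ⟨by linarith, by linarith⟩)]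
          exact le_sup_right
        · exact (eigenspace_le_spectralSpan T h).trans le_sup_left
      · rw [not_not.1 (fun h => hν (hasEigenvalue_iff.2 h))]
        exact bot_le
    · have h := ν.2
      rw [Set.mem_Ici] at h
      exact eigenspace_le_spectralSpan T (Set.mem_Ici.2 (by linarith))
    · exact eigenspace_le_spectralSpan T (Set.mem_Ici.2 le_rfl)
  have hinf : spectralSpan T (Set.Ici (μ + δ)) ⊓ eigenspace (T : End ℝ H) μ = ⊥ := by
    rw [eq_bot_iff]
    rintro v ⟨hv1, hv2⟩
    have h3 := le_inner_of_mem_spectralSpan hT (fun _ h => h) hv1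
    have h4 : T v = μ • v := mem_eigenspace_iff.1 hv2
    rw [h4, real_inner_smul_left, real_inner_self_eq_norm_sq] at h3
    have h5 : ‖v‖ ^ 2 = 0 := by nlinarith [sq_nonneg ‖v‖]
    simpa using h5
  have h := Submodule.finrank_sup_add_finrank_inf_eq (spectralSpan T (Set.Ici (μ + δ)))
    (eigenspace (T : End ℝ H) μ)
  rwa [hinf, finrank_bot, add_zero, ← hsup] at h

/-- The indices with value `μ` form the interval between the dimensions of the spectral subspaces
for `[μ + δ, ∞)` and `[μ, ∞)`; by the gap around `μ`, these dimensions differ by that of the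
eigenspace. -/
theorem encard_posEigen_eq {T : H →L[ℝ] H} (hT : T.IsSymmetric) (hc : IsCompactOperator T)
    {μ : ℝ} (hμ : 0 < μ) : {i | posEigen T i = μ}.encard =
      (finrank ℝ (eigenspace (T : End ℝ H) μ) : ℕ∞) := by
  obtain ⟨δ, hδ, hδμ, hgap⟩ := exists_eigenvalue_gap hT hc hμ
  have hfr := finrank_spectralSpan_Ici hT hc hμ hδ hgap
  have hg1 : ∀ ν, HasEigenvalue (T : End ℝ H) ν → ν ≤ μ - δ ∨ μ ≤ ν := fun ν hν => by
    by_contra! h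
    linarith [hgap ν hν (abs_lt.2 ⟨by linarith, by linarith⟩)]
  have hg2 : ∀ ν, HasEigenvalue (T : End ℝ H) ν → ν ≤ μ ∨ μ + δ ≤ ν := fun ν hν => by
    by_contra! h
    linarith [hgap ν hν (abs_lt.2 ⟨by linarith, by linarith⟩)]
  have hset : {i | posEigen T i = μ} =
      (Finset.Ico (finrank ℝ (spectralSpan T (Set.Ici (μ + δ))))
        (finrank ℝ (spectralSpan T (Set.Ici μ))) : Set ℕ) := by
    ext i
    rw [Finset.coe_Ico, Set.mem_Ico, Set.mem_ofPred_eq]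
    constructor
    · intro hi
      constructor
      · by_contra! h
        linarith [le_posEigen_of_lt_finrank hT h]
      · by_contra! h
        linarith [posEigen_le_of_finrank_le hT hc (by linarith) (by linarith) hg1 h]
    · rintro ⟨h1, h2⟩
      exact le_antisymm (posEigen_le_of_finrank_le hT hc hμ.le (by linarith) hg2 h1)
        (le_posEigen_of_lt_finrank hT h2)
  rw [hset, Set.encard_coe_eq_coe_finsetCard, Nat.card_Ico, hfr, Nat.add_sub_cancel_left]

theorem tendsto_posEigen {T : H →L[ℝ] H} (hT : T.IsSymmetric) (hc : IsCompactOperator T) :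
    Tendsto (posEigen T) atTop (𝓝 0) := by
  refine tendsto_order.2 ⟨fun a ha => Eventually.of_forall fun i =>
    ha.trans_le (posEigen_nonneg T i), fun μ hμ => ?_⟩
  obtain ⟨δ, hδ, hδμ, hgap⟩ := exists_eigenvalue_gap hT hc hμ
  filter_upwards [eventually_ge_atTop (finrank ℝ (spectralSpan T (Set.Ici μ)))] with i hi
  refine (posEigen_le_of_finrank_le hT hc (s := μ - δ) (by linarith) (by linarith)
    (fun ν hν => ?_) hi).trans_lt (by linarith)
  by_contra! h
  linarith [hgap ν hν (abs_lt.2 ⟨by linarith, by linarith⟩)]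

theorem mem_range_posEigen_iff {T : H →L[ℝ] H} (hT : T.IsSymmetric) (hc : IsCompactOperator T)
    {μ : ℝ} (hμ : 0 < μ) : μ ∈ Set.range (posEigen T) ↔ HasEigenvalue (T : End ℝ H) μ := by
  have h := encard_posEigen_eq hT hc hμ
  have hfd := ContinuousLinearMap.finite_dimensional_eigenspace hc μ hμ.ne'
  have h1 : μ ∈ Set.range (posEigen T) ↔ {i | posEigen T i = μ}.encard ≠ 0 := by
    rw [Set.encard_ne_zero]
    rfl
  rw [h1, h, hasEigenvalue_iff, Nat.cast_ne_zero, Ne, Submodule.finrank_eq_zero]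

end MinMax

/-! ### Spectral listings on `L²([0,1])`: existence, similarity, and `T ↦ 1 - T` -/

/-- Polynomials embed: two that agree almost everywhere agree at infinitely many points, finite sets
being null. This is what puts `0` in the spectrum of every compact operator. -/
theorem not_finiteDimensional_L2 : ¬ FiniteDimensional ℝ L2 := by
  intro h
  let f : Polynomial ℝ →ₗ[ℝ] L2 :=
    (ContinuousMap.toLp 2 (volume : Measure I) ℝ : C(I, ℝ) →L[ℝ] L2).toLinearMap ∘ₗ
      (Polynomial.toContinuousMapOnAlgHom (R := ℝ) I).toLinearMap
  have hf : Function.Injective f := by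
    intro p q hpq
    have hae : ∀ᵐ x : I, p.eval (x : ℝ) = q.eval (x : ℝ) := by
      have h1 := ContinuousMap.coeFn_toLp (p := 2) (𝕜 := ℝ) (volume : Measure I)
        (p.toContinuousMapOn I)
      have h2 := ContinuousMap.coeFn_toLp (p := 2) (𝕜 := ℝ) (volume : Measure I)
        (q.toContinuousMapOn I)
      filter_upwards [h1, h2] with x hx1 hx2
      exact hx1.symm.trans ((congrArg (fun g : L2 => g x) hpq).trans hx2)
    have hinf : {x : I | p.eval (x : ℝ) = q.eval (x : ℝ)}.Infinite := by
      intro hfin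
      have h0 := hfin.measure_zero (volume : Measure I)
      obtain ⟨x, hx, hx'⟩ := (hae.and (measure_eq_zero_iff_ae_notMem.1 h0)).exists
      exact hx' hx
    refine Polynomial.eq_of_infinite_eval_eq p q
      ((hinf.image Subtype.val_injective.injOn).mono ?_)
    rintro _ ⟨x, hx, rfl⟩
    exact hx
  exact Polynomial.not_finite (R := ℝ) (Module.Finite.of_injective f hf)

theorem zero_mem_spectrum {T : L2 →L[ℝ] L2} (hc : IsCompactOperator T) : 0 ∈ spectrum ℝ T := by
  rw [spectrum.zero_mem_iff]
  rintro ⟨u, rfl⟩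
  refine not_finiteDimensional_L2 (FiniteDimensional.of_isCompactOperator_id (𝕜 := ℝ) ?_)
  have h := hc.clm_comp (↑u⁻¹ : L2 →L[ℝ] L2)
  convert! h using 1
  ext1 v
  have h1 : (↑u⁻¹ * ↑u : L2 →L[ℝ] L2) v = v := by rw [Units.inv_mul]; rfl
  exact h1.symm

/-- Spectral theorem for compact self-adjoint operators on `L²([0,1])`, with the eigenvalues
listed by the min-max principle. -/
theorem isSpectralListing_posEigen {T : L2 →L[ℝ] L2} (hT : T.IsSymmetric)
    (hc : IsCompactOperator T) :
    IsSpectralListing T 0 (posEigen T) (fun i => -posEigen (-T) i) := by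
  have hTn : (-T).IsSymmetric := fun v w => by
    have := hT v w
    simpa using this
  have hcn : IsCompactOperator (-T) := hc.neg
  refine ⟨antitone_posEigen T, fun i j hij => neg_le_neg (antitone_posEigen (-T) hij),
    posEigen_nonneg T, fun i => neg_nonpos.2 (posEigen_nonneg _ i), tendsto_posEigen hT hc, ?_, ?_,
    fun μ hμ => ContinuousLinearMap.finite_dimensional_eigenspace hc μ hμ,
    fun μ hμ => encard_posEigen_eq hT hc hμ, fun μ hμ => ?_⟩
  · simpa using (tendsto_posEigen hTn hcn).neg
  · ext μ
    rw [Set.mem_insert_iff, Set.mem_union]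
    rcases lt_trichotomy μ 0 with hμ | rfl | hμ
    · have h1 : μ ∉ Set.range (posEigen T) := by
        rintro ⟨i, rfl⟩
        exact hμ.not_ge (posEigen_nonneg T i)
      have h2 : μ ∈ Set.range (fun i => -posEigen (-T) i) ↔ -μ ∈ Set.range (posEigen (-T)) := by
        simp [neg_eq_iff_eq_neg]
      rw [h2, mem_range_posEigen_iff hTn hcn (neg_pos.2 hμ), Module.End.hasEigenvalue_iff,
        eigenspace_neg, ← Module.End.hasEigenvalue_iff, hc.hasEigenvalue_iff_mem_spectrum hμ.ne]
      simp [hμ.ne, h1]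
    · simp [zero_mem_spectrum hc]
    · have h1 : μ ∉ Set.range (fun i => -posEigen (-T) i) := by
        rintro ⟨i, rfl⟩
        exact hμ.not_ge (neg_nonpos.2 (posEigen_nonneg _ i))
      rw [mem_range_posEigen_iff hT hc hμ, hc.hasEigenvalue_iff_mem_spectrum hμ.ne']
      simp [hμ.ne', h1]
  · have h := encard_posEigen_eq hTn hcn (neg_pos.2 hμ)
    rw [eigenspace_neg] at h
    rw [← h]
    congr 1
    ext i
    simp [neg_eq_iff_eq_neg]

/-- Similarity suffices; `M` need not be an isometry, so the listing of a self-adjoint operator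
passes to a non-self-adjoint one. -/
theorem IsSpectralListing.conj {T : L2 →L[ℝ] L2} {c : ℝ} {a b : ℕ → ℝ}
    (h : IsSpectralListing T c a b) (M : L2 ≃L[ℝ] L2) {S : L2 →L[ℝ] L2}
    (hS : ∀ v, M (S v) = T (M v)) : IsSpectralListing S c a b := by
  have he (μ : ℝ) : Module.End.eigenspace (S : Module.End ℝ L2) μ =
      (Module.End.eigenspace (T : Module.End ℝ L2) μ).comap M.toLinearEquiv.toLinearMap := by
    ext v
    rw [Submodule.mem_comap, Module.End.mem_eigenspace_iff, Module.End.mem_eigenspace_iff]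
    change S v = μ • v ↔ T (M v) = μ • M v
    rw [← hS, ← map_smul, M.injective.eq_iff]
  have hequiv (μ : ℝ) : Module.End.eigenspace (S : Module.End ℝ L2) μ ≃ₗ[ℝ]
      Module.End.eigenspace (T : Module.End ℝ L2) μ := by
    rw [he μ]
    exact LinearEquiv.ofSubmodule' M.toLinearEquiv _
  have hspec : spectrum ℝ S = spectrum ℝ T := by
    rw [ContinuousLinearMap.spectrum_eq, ContinuousLinearMap.spectrum_eq,
      ← AlgEquiv.spectrum_eq (M.toLinearEquiv.conjAlgEquiv ℝ) (S : Module.End ℝ L2)]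
    congr 1
    ext1 v
    change M (S (M.symm v)) = T v
    rw [hS, M.apply_symm_apply]
  refine ⟨h.antitone_above, h.monotone_below, h.le_above, h.below_le, h.tendsto_above,
    h.tendsto_below, hspec.trans h.spectrum_eq, fun μ hμ => ?_, fun μ hμ => ?_, fun μ hμ => ?_⟩
  · have := h.finite_multiplicity μ hμ
    exact (hequiv μ).symm.finiteDimensional
  · rw [h.multiplicity_above μ hμ, (hequiv μ).finrank_eq]
  · rw [h.multiplicity_below μ hμ, (hequiv μ).finrank_eq]

open scoped Pointwise in
theorem IsSpectralListing.id_sub {T : L2 →L[ℝ] L2} {a b : ℕ → ℝ}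
    (h : IsSpectralListing T 0 a b) :
    IsSpectralListing (ContinuousLinearMap.id ℝ L2 - T) 1 (fun i => 1 - b i)
      (fun i => 1 - a i) := by
  have he (μ : ℝ) : Module.End.eigenspace
      ((ContinuousLinearMap.id ℝ L2 - T : L2 →L[ℝ] L2) : Module.End ℝ L2) μ =
      Module.End.eigenspace (T : Module.End ℝ L2) (1 - μ) := by
    ext v
    rw [Module.End.mem_eigenspace_iff, Module.End.mem_eigenspace_iff]
    change v - T v = μ • v ↔ T v = (1 - μ) • v
    rw [sub_smul, one_smul]
    constructor <;> intro h
    · rw [← h, sub_sub_cancel]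
    · rw [h, sub_sub_cancel]
  have hset (f : ℕ → ℝ) (μ : ℝ) : {i | 1 - f i = μ} = {i | f i = 1 - μ} := by
    ext i
    simp only [Set.mem_ofPred_eq]
    constructor <;> intro h <;> linarith
  refine ⟨fun i j hij => sub_le_sub_left (h.monotone_below hij) 1,
    fun i j hij => sub_le_sub_left (h.antitone_above hij) 1,
    fun i => by linarith [h.below_le i], fun i => by linarith [h.le_above i],
    by simpa using h.tendsto_below.const_sub 1, by simpa using h.tendsto_above.const_sub 1, ?_,
    fun μ hμ => ?_, fun μ hμ => ?_, fun μ hμ => ?_⟩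
  · have h1 : spectrum ℝ (ContinuousLinearMap.id ℝ L2 - T) = {(1 : ℝ)} - spectrum ℝ T := by
      rw [spectrum.singleton_sub_eq, map_one]
      rfl
    rw [h1, h.spectrum_eq]
    ext μ
    simp only [Set.singleton_sub, Set.mem_image, Set.mem_insert_iff, Set.mem_union, Set.mem_range]
    constructor
    · rintro ⟨x, rfl | ⟨i, rfl⟩ | ⟨i, rfl⟩, rfl⟩
      · simp
      · exact Or.inr (Or.inr ⟨i, rfl⟩)
      · exact Or.inr (Or.inl ⟨i, rfl⟩)
    · rintro (rfl | ⟨i, rfl⟩ | ⟨i, rfl⟩)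
      · exact ⟨0, Or.inl rfl, by simp⟩
      · exact ⟨b i, Or.inr (Or.inr ⟨i, rfl⟩), rfl⟩
      · exact ⟨a i, Or.inr (Or.inl ⟨i, rfl⟩), rfl⟩
  · rw [he]
    exact h.finite_multiplicity _ (sub_ne_zero.2 hμ.symm)
  · rw [he, hset, h.multiplicity_below _ (by linarith)]
  · rw [he, hset, h.multiplicity_above _ (by linarith)]

/-! ### Integral operators on `L²([0,1])` -/

section Kernel

variable {K K' : I × I → ℝ}

theorem memLp_two_mul_prod {f g : I → ℝ} (hf : MemLp f 2) (hg : MemLp g 2) :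
    MemLp (fun z : I × I => f z.2 * g z.1) 2 := by
  have hm : AEStronglyMeasurable (fun z : I × I => f z.2 * g z.1)
      ((volume : Measure I).prod volume) := hf.1.comp_snd.mul hg.1.comp_fst
  refine (memLp_two_iff_integrable_sq hm).2 ?_
  have h := hg.integrable_sq.mul_prod hf.integrable_sq
  refine h.congr (ae_of_all _ fun z => ?_)
  ring

theorem integrable_kernel_mul (hK : MemLp K 2) {f g : I → ℝ} (hf : MemLp f 2) (hg : MemLp g 2) :
    Integrable (fun z : I × I => K z * f z.2 * g z.1) := by
  have h := hK.integrable_mul (memLp_two_mul_prod hf hg)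
  refine h.congr (ae_of_all _ fun z => ?_)
  simp only [Pi.mul_apply]
  ring

/-- The weak form, through which identities between kernel operators reduce to identities between
double integrals. -/
theorem inner_kernelOp (hK : MemLp K 2) (f g : L2) :
    inner ℝ (kernelOp hK f) g = ∫ z : I × I, K z * f z.2 * g z.1 := by
  have hi := integrable_kernel_mul hK (Lp.memLp f) (Lp.memLp g)
  rw [Measure.volume_eq_prod] at hi ⊢
  rw [integral_prod _ hi, L2.inner_def]
  refine integral_congr_ae ?_
  filter_upwards [kernelOp_apply hK f] with x hx
  rw [hx, integral_mul_const]
  simp only [RCLike.inner_apply, conj_trivial]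
  ring

theorem kernelOp_congr (hK : MemLp K 2) (hK' : MemLp K' 2) (h : K =ᵐ[volume] K') :
    kernelOp hK = kernelOp hK' := by
  ext1 f
  refine ext_inner_right ℝ fun g => ?_
  rw [inner_kernelOp, inner_kernelOp]
  refine integral_congr_ae ?_
  filter_upwards [h] with z hz
  rw [hz]

theorem kernelOp_sub (hK : MemLp K 2) (hK' : MemLp K' 2) :
    kernelOp (hK.sub hK') = kernelOp hK - kernelOp hK' := by
  ext1 f
  refine ext_inner_right ℝ fun g => ?_
  rw [sub_apply, inner_sub_left, inner_kernelOp, inner_kernelOp, inner_kernelOp,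
    ← integral_sub (integrable_kernel_mul hK (Lp.memLp f) (Lp.memLp g))
      (integrable_kernel_mul hK' (Lp.memLp f) (Lp.memLp g))]
  refine integral_congr_ae (ae_of_all _ fun z => ?_)
  simp only [Pi.sub_apply]
  ring

theorem norm_kernelOp_le (hK : MemLp K 2) : ‖kernelOp hK‖ ≤ (eLpNorm K 2).toReal :=
  LinearMap.mkContinuous_norm_le _ ENNReal.toReal_nonneg _

theorem inner_kernelOp_swap (hK : MemLp K 2) (hK' : MemLp (fun z : I × I => K z.swap) 2)
    (f g : L2) : inner ℝ (kernelOp hK f) g = inner ℝ f (kernelOp hK' g) := by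
  rw [real_inner_comm _ f, inner_kernelOp, inner_kernelOp]
  have h := (Measure.measurePreserving_swap (μ := (volume : Measure I)) (ν := volume)).integral_comp
    MeasurableEquiv.prodComm.measurableEmbedding (fun z : I × I => K z * f z.2 * g z.1)
  rw [Measure.volume_eq_prod, ← h]
  refine integral_congr_ae (ae_of_all _ fun z => ?_)
  simp only [Prod.fst_swap, Prod.snd_swap]
  ring

theorem isSymmetric_kernelOp (hK : MemLp K 2) (hs : ∀ x y, K (x, y) = K (y, x)) :
    (kernelOp hK).IsSymmetric := fun f g => by
  have h : (fun z : I × I => K z.swap) = K := funext fun z => hs _ _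
  have hK' : MemLp (fun z : I × I => K z.swap) 2 := by rwa [h]
  refine (inner_kernelOp_swap hK hK' f g).trans ?_
  rw [kernelOp_congr hK' hK (by rw [h])]
  rfl

/-! #### Compactness -/

/-- The operator has rank at most one: it is `f ↦ ⟨h, f⟩ g`, which factors through `ℝ`. -/
theorem isCompactOperator_kernelOp_mul (g h : C(I, ℝ))
    (hK : MemLp (fun z : I × I => g z.1 * h z.2) 2) : IsCompactOperator (kernelOp hK) := by
  have hm (u : C(I, ℝ)) : MemLp u 2 (volume : Measure I) :=
    MemLp.of_bound u.continuous.aestronglyMeasurable ‖u‖ (ae_of_all _ u.norm_coe_le_norm)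
  let g' : L2 := (hm g).toLp g
  let h' : L2 := (hm h).toLp h
  have heq : kernelOp hK = (ContinuousLinearMap.toSpanSingleton ℝ g') ∘L (innerSL ℝ h') := by
    ext1 f
    refine Lp.ext ?_
    filter_upwards [kernelOp_apply hK f, Lp.coeFn_smul (inner ℝ h' f) g', (hm g).coeFn_toLp]
      with x h1 h2 h3
    rw [h1]
    change _ = ((inner ℝ h' f) • g' : L2) x
    rw [h2, Pi.smul_apply, h3, L2.inner_def, smul_eq_mul, ← integral_mul_const]
    refine integral_congr_ae ?_
    filter_upwards [(hm h).coeFn_toLp] with y hy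
    rw [hy]
    simp only [RCLike.inner_apply, conj_trivial]
    ring
  rw [heq]
  exact (isCompactOperator_of_locallyCompactSpace_rng
    (ContinuousLinearMap.toSpanSingleton ℝ g')).comp_clm (innerSL ℝ h')

theorem memLp_of_continuousMap (k : C(I × I, ℝ)) : MemLp k 2 (volume : Measure (I × I)) :=
  MemLp.of_bound k.continuous.aestronglyMeasurable ‖k‖ (ae_of_all _ k.norm_coe_le_norm)

open scoped TensorProduct in
/-- The algebra homomorphism sending `g ⊗ h` to `(x, y) ↦ g x * h y`. -/
def tensorKernel : C(I, ℝ) ⊗[ℝ] C(I, ℝ) →ₐ[ℝ] C(I × I, ℝ) :=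
  Algebra.TensorProduct.productMap (ContinuousMap.compRightAlgHom ℝ ℝ ContinuousMap.fst)
    (ContinuousMap.compRightAlgHom ℝ ℝ ContinuousMap.snd)

theorem kernelOp_add (hK : MemLp K 2) (hK' : MemLp K' 2) :
    kernelOp (hK.add hK') = kernelOp hK + kernelOp hK' := by
  ext1 f
  refine ext_inner_right ℝ fun g => ?_
  rw [add_apply, inner_add_left, inner_kernelOp, inner_kernelOp, inner_kernelOp,
    ← integral_add (integrable_kernel_mul hK (Lp.memLp f) (Lp.memLp g))
      (integrable_kernel_mul hK' (Lp.memLp f) (Lp.memLp g))]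
  refine integral_congr_ae (ae_of_all _ fun z => ?_)
  simp only [Pi.add_apply]
  ring

open scoped TensorProduct in
theorem isCompactOperator_kernelOp_tensorKernel (w : C(I, ℝ) ⊗[ℝ] C(I, ℝ)) :
    IsCompactOperator (kernelOp (memLp_of_continuousMap (tensorKernel w))) := by
  induction w using TensorProduct.induction_on with
  | zero =>
    have h : kernelOp (memLp_of_continuousMap (tensorKernel 0)) = 0 := by
      rw [← norm_eq_zero]
      refine le_antisymm ((norm_kernelOp_le _).trans ?_) (norm_nonneg _)
      rw [map_zero, ContinuousMap.coe_zero, eLpNorm_zero]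
      simp
    rw [h]
    exact isCompactOperator_zero
  | tmul g h =>
    have hm : MemLp (fun z : I × I => g z.1 * h z.2) 2 :=
      memLp_of_continuousMap ⟨fun z : I × I => g z.1 * h z.2, by fun_prop⟩
    rw [kernelOp_congr _ hm (ae_of_all _ fun z => by
      rw [tensorKernel, Algebra.TensorProduct.productMap_apply_tmul]; rfl)]
    exact isCompactOperator_kernelOp_mul g h hm
  | add v w hv hw =>
    have hv' := memLp_of_continuousMap (tensorKernel v)
    have hw' := memLp_of_continuousMap (tensorKernel w)
    rw [kernelOp_congr _ (hv'.add hw') (ae_of_all _ fun z => by rw [map_add]; rfl),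
      kernelOp_add hv' hw']
    exact hv.add hw

theorem separatesPoints_range_tensorKernel : tensorKernel.range.SeparatesPoints := by
  intro x y hxy
  let ι : C(I, ℝ) := ⟨Subtype.val, continuous_subtype_val⟩
  by_cases h : x.1 = y.1
  · have h2 : x.2 ≠ y.2 := fun h2 => hxy (Prod.ext h h2)
    refine ⟨_, ⟨tensorKernel (TensorProduct.tmul ℝ 1 ι), ⟨_, rfl⟩, rfl⟩, ?_⟩
    rw [tensorKernel, Algebra.TensorProduct.productMap_apply_tmul, map_one, one_mul]
    exact fun h' => h2 (Subtype.ext h')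
  · refine ⟨_, ⟨tensorKernel (TensorProduct.tmul ℝ ι 1), ⟨_, rfl⟩, rfl⟩, ?_⟩
    rw [tensorKernel, Algebra.TensorProduct.productMap_apply_tmul, map_one, mul_one]
    exact fun h' => h (Subtype.ext h')

/-- Hilbert–Schmidt integral operators are compact. -/
theorem isCompactOperator_kernelOp (hK : MemLp K 2) : IsCompactOperator (kernelOp hK) := by
  have hcl := (isClosed_setOfPred_isCompactOperator (𝕜₁ := ℝ) (𝕜₂ := ℝ) (σ₁₂ := RingHom.id ℝ)
    (M₁ := L2) (M₂ := L2))
  refine hcl.closure_subset (Metric.mem_closure_iff.2 fun ε hε => ?_)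
  -- The operator norm is at most the `L²` norm of the kernel, so it suffices to approximate `K` in
  -- `L²` by a continuous kernel and that one uniformly, by Stone–Weierstrass, by a sum of products.
  obtain ⟨k, hk, hkm⟩ := hK.exists_boundedContinuous_eLpNorm_sub_le ENNReal.ofNat_ne_top
    (ε := ENNReal.ofReal (ε / 4)) (by simpa using by positivity)
  obtain ⟨⟨_, w, rfl⟩, hw⟩ :=
    ContinuousMap.exists_mem_subalgebra_near_continuousMap_of_separatesPoints _
      separatesPoints_range_tensorKernel k.toContinuousMap (ε / 4) (by positivity)
  have hs := memLp_of_continuousMap (tensorKernel w)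
  refine ⟨kernelOp hs, isCompactOperator_kernelOp_tensorKernel w, ?_⟩
  have h1 : ‖kernelOp hK - kernelOp hkm‖ ≤ ε / 4 := by
    rw [← kernelOp_sub]
    refine (norm_kernelOp_le _).trans ?_
    exact ENNReal.toReal_le_of_le_ofReal (by positivity) hk
  have h2 : ‖kernelOp hkm - kernelOp hs‖ ≤ ε / 4 := by
    rw [← kernelOp_sub]
    refine (norm_kernelOp_le _).trans (ENNReal.toReal_le_of_le_ofReal (by positivity) ?_)
    refine (eLpNorm_le_of_ae_bound (C := ε / 4) (ae_of_all _ fun z => ?_)).trans ?_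
    · rw [Pi.sub_apply, norm_sub_rev]
      exact (ContinuousMap.norm_coe_le_norm (tensorKernel w - k.toContinuousMap) z).trans hw.le
    · simp
  rw [dist_eq_norm, ← sub_add_sub_cancel _ (kernelOp hkm)]
  exact (norm_add_le _ _).trans_lt (by linarith)

/-! #### Relabelling by a measure preserving map -/

/-- Composition with a measure preserving map, as an isometry of `L²([0,1])`. -/
def compIsometry {φ : I → I} (hφ : MeasurePreserving φ volume volume) : L2 →ₗᵢ[ℝ] L2 :=
  Lp.compMeasurePreservingₗᵢ ℝ φ hφ

theorem memLp_comp_prod (hK : MemLp K 2) {φ ψ : I → I} (hφ : MeasurePreserving φ volume volume)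
    (hψ : MeasurePreserving ψ volume volume) : MemLp (fun z : I × I => K (φ z.1, ψ z.2)) 2 :=
  hK.comp_measurePreserving (hφ.prod hψ)

theorem kernelOp_comp_fst (hK : MemLp K 2) {φ : I → I} (hφ : MeasurePreserving φ volume volume)
    (hK' : MemLp (fun z : I × I => K (φ z.1, z.2)) 2) :
    kernelOp hK' = (compIsometry hφ).toContinuousLinearMap ∘L kernelOp hK := by
  ext1 f
  refine Lp.ext ?_
  filter_upwards [kernelOp_apply hK' f, Lp.coeFn_compMeasurePreserving (kernelOp hK f) hφ,
    hφ.quasiMeasurePreserving.ae (kernelOp_apply hK f)] with x h1 h2 h3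
  rw [h1]
  exact (h2.trans h3).symm

/-- Relabelling the first variable is composition with `J` on the left. Relabelling the second is
the transpose of this, and since `K` is symmetric it gives `(J T)* = T J*`. -/
theorem kernelOp_comp_comp (hK : MemLp K 2) (hs : ∀ x y, K (x, y) = K (y, x)) {φ : I → I}
    (hφ : MeasurePreserving φ volume volume)
    (hK' : MemLp (fun z : I × I => K (φ z.1, φ z.2)) 2) :
    kernelOp hK' = (compIsometry hφ).toContinuousLinearMap ∘L kernelOp hK ∘L
      ContinuousLinearMap.adjoint (compIsometry hφ).toContinuousLinearMap := by
  have h1 : MemLp (fun z : I × I => K (φ z.1, z.2)) 2 :=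
    memLp_comp_prod hK hφ (MeasurePreserving.id _)
  have h2 : MemLp (fun z : I × I => K (z.1, φ z.2)) 2 :=
    memLp_comp_prod hK (MeasurePreserving.id _) hφ
  rw [kernelOp_comp_fst h2 hφ hK']
  congr 1
  ext1 f
  refine ext_inner_right ℝ fun g => ?_
  have h1' : MemLp (fun z : I × I => (fun w : I × I => K (w.1, φ w.2)) z.swap) 2 := by
    convert! h1 using 2 with z
    exact hs _ _
  have h3 : kernelOp h1' = kernelOp h1 := by
    congr 1
    ext z
    exact hs _ _
  rw [inner_kernelOp_swap h2 h1', h3, kernelOp_comp_fst hK hφ h1]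
  change inner ℝ f ((compIsometry hφ).toContinuousLinearMap (kernelOp hK g)) =
    inner ℝ (kernelOp hK (ContinuousLinearMap.adjoint
      (compIsometry hφ).toContinuousLinearMap f)) g
  rw [← ContinuousLinearMap.adjoint_inner_left]
  exact (isSymmetric_kernelOp hK hs _ _).symm

end Kernel

/-! ### Operator norm and cut norm -/

section OperatorNorm

variable {D : I × I → ℝ}

theorem abs_integral_kernel_le {B : ℝ} (hD : MemLp D 2) (hB : ∀ z, |D z| ≤ B) {u v : I → ℝ}
    (hu : MemLp u 2) (hv : MemLp v 2) :
    |∫ z : I × I, D z * u z.2 * v z.1| ≤ B * ((∫ x, |u x|) * ∫ x, |v x|) := by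
  have hu1 : Integrable u := hu.integrable one_le_two
  have hv1 : Integrable v := hv.integrable one_le_two
  have hprod : ∫ z : I × I, |v z.1| * |u z.2| = (∫ x, |v x|) * ∫ x, |u x| :=
    integral_prod_mul (μ := (volume : Measure I)) (ν := volume) (fun x => |v x|) (fun x => |u x|)
  have hint : Integrable (fun z : I × I => |v z.1| * |u z.2|) := hv1.abs.mul_prod hu1.abs
  rw [mul_comm (∫ x, |u x|), ← hprod, ← integral_const_mul]
  refine (abs_integral_le_integral_abs).trans
    (integral_mono (integrable_kernel_mul hD hu hv).abs (hint.const_mul B) fun z => ?_)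
  simp only [abs_mul]
  rw [mul_assoc, mul_comm |u z.2|]
  exact mul_le_mul_of_nonneg_right (hB z) (by positivity)

/-- For a bounded kernel, smallness against bounded test functions gives smallness of the operator
norm on `L²`. -/
theorem norm_kernelOp_le_of_bounded (hD : MemLp D 2) {B δ M : ℝ} (hB : ∀ z, |D z| ≤ B)
    (hM : 0 < M) (hδ : ∀ f g : I → ℝ, Measurable f → Measurable g → (∀ x, |f x| ≤ 1) →
      (∀ x, |g x| ≤ 1) → |∫ z : I × I, D z * f z.2 * g z.1| ≤ δ) :
    ‖kernelOp hD‖ ≤ M ^ 2 * δ + 2 * B / M := by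
  have hδ0 : 0 ≤ δ := (abs_nonneg _).trans
    (hδ 0 0 measurable_const measurable_const (by simp) (by simp))
  have hB0 : 0 ≤ B := (abs_nonneg _).trans (hB (0, 0))
  refine ContinuousLinearMap.opNorm_le_of_re_inner_le (𝕜 := ℝ) (by positivity) fun f g hf hg => ?_
  have hsq (f : L2) (hf : ‖f‖ = 1) : ∫ x, f x ^ 2 = 1 := by
    have h := real_inner_self_eq_norm_sq f
    rw [L2.inner_def, hf] at h
    simp only [RCLike.inner_apply, conj_trivial] at h
    rw [one_pow] at h
    rw [← h]
    exact integral_congr_ae (ae_of_all _ fun x => by ring)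
  have hmeas (f : L2) : Measurable f := (Lp.stronglyMeasurable f).measurable
  -- Truncation at height `M`: where `|f| > M` one has `|f| ≤ f² / M`, so the tail of a unit vector
  -- has `L¹` norm at most `1 / M`.
  let tr (f : L2) (x : I) : ℝ := if |f x| ≤ M then f x else 0
  have htrm (f : L2) : Measurable (tr f) :=
    Measurable.ite (measurableSet_le (hmeas f).abs measurable_const) (hmeas f) measurable_const
  have htrM (f : L2) (x : I) : |tr f x| ≤ M := by
    simp only [tr]
    split_ifs with h
    · exact h
    · simpa using hM.le
  have htrf (f : L2) (x : I) : |tr f x| ≤ |f x| := by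
    simp only [tr]
    split_ifs with h
    · exact le_rfl
    · simp
  have hres (f : L2) (x : I) : |f x - tr f x| ≤ f x ^ 2 / M := by
    simp only [tr]
    split_ifs with h
    · simp only [sub_self, abs_zero]; positivity
    · rw [sub_zero, le_div_iff₀ hM, ← sq_abs, sq]
      exact mul_le_mul_of_nonneg_left (not_le.1 h).le (abs_nonneg _)
  have htrL (f : L2) : MemLp (tr f) 2 :=
    (Lp.memLp f).mono (htrm f).aestronglyMeasurable (ae_of_all _ (htrf f))
  have hresL (f : L2) : MemLp (fun x => f x - tr f x) 2 := (Lp.memLp f).sub (htrL f)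
  have hf1 (f : L2) (hf : ‖f‖ = 1) : ∫ x, |f x| ≤ 1 := by
    have hi := (Lp.memLp f).integrable_sq
    have h1 : ∫ x, |f x| ≤ ∫ x, (1 + f x ^ 2) / 2 := by
      refine integral_mono ((Lp.memLp f).integrable one_le_two).abs
        (((integrable_const _).add hi).div_const 2) fun x => ?_
      have := sq_nonneg (|f x| - 1)
      have h2 := sq_abs (f x)
      simp only
      nlinarith
    rw [integral_div, integral_add (integrable_const _) hi, hsq f hf] at h1
    simpa using h1
  have htr1 (f : L2) (hf : ‖f‖ = 1) : ∫ x, |tr f x| ≤ 1 :=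
    (integral_mono ((htrL f).integrable one_le_two).abs
      ((Lp.memLp f).integrable one_le_two).abs (htrf f)).trans (hf1 f hf)
  have hres1 (f : L2) (hf : ‖f‖ = 1) : ∫ x, |f x - tr f x| ≤ 1 / M := by
    refine (integral_mono ((hresL f).integrable one_le_two).abs
      ((Lp.memLp f).integrable_sq.div_const M) (hres f)).trans ?_
    rw [integral_div, hsq f hf]
  have hnn (u : I → ℝ) : 0 ≤ ∫ x, |u x| := integral_nonneg fun x => abs_nonneg _
  have hsplit : ∫ z : I × I, D z * f z.2 * g z.1 =
      (∫ z : I × I, D z * tr f z.2 * tr g z.1) +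
      (∫ z : I × I, D z * (f z.2 - tr f z.2) * tr g z.1) +
      ∫ z : I × I, D z * f z.2 * (g z.1 - tr g z.1) := by
    rw [← integral_add' (integrable_kernel_mul hD (htrL f) (htrL g))
      (integrable_kernel_mul hD (hresL f) (htrL g)), ← integral_add'
      ((integrable_kernel_mul hD (htrL f) (htrL g)).add
        (integrable_kernel_mul hD (hresL f) (htrL g)))
      (integrable_kernel_mul hD (Lp.memLp f) (hresL g))]
    exact integral_congr_ae (ae_of_all _ fun z => by simp only [Pi.add_apply]; ring)
  -- Dividing both truncations by `M` makes them admissible test functions, at the cost of `M ^ 2`.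
  have hI1 : ∫ z : I × I, D z * tr f z.2 * tr g z.1 ≤ M ^ 2 * δ := by
    have h := hδ (fun x => tr f x / M) (fun x => tr g x / M) ((htrm f).div_const M)
      ((htrm g).div_const M)
      (fun x => by rw [abs_div, abs_of_pos hM, div_le_one hM]; exact htrM f x)
      (fun x => by rw [abs_div, abs_of_pos hM, div_le_one hM]; exact htrM g x)
    have h2 : ∫ z : I × I, D z * tr f z.2 * tr g z.1 =
        M ^ 2 * ∫ z : I × I, D z * (tr f z.2 / M) * (tr g z.1 / M) := by
      rw [← integral_const_mul]
      refine integral_congr_ae (ae_of_all _ fun z => ?_)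
      simp only
      field_simp
    rw [h2]
    exact mul_le_mul_of_nonneg_left ((le_abs_self _).trans h) (by positivity)
  have hI2 : ∫ z : I × I, D z * (f z.2 - tr f z.2) * tr g z.1 ≤ B / M := by
    refine (le_abs_self _).trans ((abs_integral_kernel_le hD hB (hresL f) (htrL g)).trans ?_)
    rw [div_eq_mul_one_div]
    refine mul_le_mul_of_nonneg_left ?_ hB0
    calc _ ≤ 1 / M * 1 := mul_le_mul (hres1 f hf) (htr1 g hg) (hnn _) (by positivity)
      _ = 1 / M := mul_one _
  have hI3 : ∫ z : I × I, D z * f z.2 * (g z.1 - tr g z.1) ≤ B / M := by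
    refine (le_abs_self _).trans ((abs_integral_kernel_le hD hB (Lp.memLp f) (hresL g)).trans ?_)
    rw [div_eq_mul_one_div]
    refine mul_le_mul_of_nonneg_left ?_ hB0
    calc _ ≤ 1 * (1 / M) := mul_le_mul (hf1 f hf) (hres1 g hg) (hnn _) zero_le_one
      _ = 1 / M := one_mul _
  change inner ℝ (kernelOp hD f) g ≤ _
  have h2B : 2 * B / M = B / M + B / M := by ring
  rw [inner_kernelOp, hsplit, h2B]
  linarith

end OperatorNorm

section CutNorm

variable {U : I × I → ℝ}

theorem abs_integral_le_cutNorm (hU : ∀ z, |U z| ≤ 1) {f g : I → I}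
    (hf : Measurable f) (hg : Measurable g) :
    |∫ z : I × I, U z * (f z.1 : ℝ) * (g z.2 : ℝ)| ≤ cutNorm U := by
  refine le_ciSup (f := fun p : {p : (I → I) × (I → I) // Measurable p.1 ∧ Measurable p.2} =>
    |∫ z : I × I, U z * (p.1.1 z.1 : ℝ) * (p.1.2 z.2 : ℝ)|) ?_ ⟨(f, g), hf, hg⟩
  -- The supremum is a real `⨆`, meaningful only once the family is known to be bounded above.
  refine ⟨1, ?_⟩
  rintro _ ⟨p, rfl⟩
  have h := norm_integral_le_of_norm_le_const (μ := (volume : Measure (I × I))) (C := 1)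
    (f := fun z : I × I => U z * (p.1.1 z.1 : ℝ) * (p.1.2 z.2 : ℝ)) (ae_of_all _ fun z => ?_)
  · simpa using h
  · rw [norm_mul, norm_mul, Real.norm_eq_abs, Real.norm_eq_abs, Real.norm_eq_abs,
      abs_of_nonneg (p.1.1 z.1).2.1, abs_of_nonneg (p.1.2 z.2).2.1]
    exact mul_le_one₀ (mul_le_one₀ (hU z) (p.1.1 z.1).2.1 (p.1.1 z.1).2.2)
      (p.1.2 z.2).2.1 (p.1.2 z.2).2.2

/-- Splitting `f` and `g` into positive and negative parts gives four integrals with test functions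
valued in `[0,1]`. -/
theorem abs_integral_le_four_mul_cutNorm (hUm : Measurable U) (hU : ∀ z, |U z| ≤ 1) {f g : I → ℝ}
    (hf : Measurable f) (hg : Measurable g) (hf1 : ∀ x, |f x| ≤ 1) (hg1 : ∀ x, |g x| ≤ 1) :
    |∫ z : I × I, U z * f z.1 * g z.2| ≤ 4 * cutNorm U := by
  -- For `|f| ≤ 1`, clamping to `[0,1]` is taking the positive part.
  let P (f : I → ℝ) (x : I) : I := Set.projIcc 0 1 zero_le_one (f x)
  have hPm {f : I → ℝ} (hf : Measurable f) : Measurable (P f) :=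
    continuous_projIcc.measurable.comp hf
  have hsplit {f : I → ℝ} (hf1 : ∀ x, |f x| ≤ 1) (x : I) :
      f x = (P f x : ℝ) - (P (fun x => -f x) x : ℝ) := by
    have h := abs_le.1 (hf1 x)
    simp only [P, Set.coe_projIcc]
    rcases le_total 0 (f x) with h0 | h0
    · rw [min_eq_right h.2, max_eq_right h0, min_eq_right (by linarith), max_eq_left (by linarith)]
      ring
    · rw [min_eq_right h.2, max_eq_left h0, min_eq_right (by linarith), max_eq_right (by linarith)]
      ring
  have hint {p q : I → I} (hp : Measurable p) (hq : Measurable q) :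
      Integrable (fun z : I × I => U z * (p z.1 : ℝ) * (q z.2 : ℝ)) := by
    refine Integrable.of_bound (C := 1) (Measurable.aestronglyMeasurable (by fun_prop))
      (ae_of_all _ fun z => ?_)
    rw [norm_mul, norm_mul, Real.norm_eq_abs, Real.norm_eq_abs, Real.norm_eq_abs,
      abs_of_nonneg (p z.1).2.1, abs_of_nonneg (q z.2).2.1]
    exact mul_le_one₀ (mul_le_one₀ (hU z) (p z.1).2.1 (p z.1).2.2) (q z.2).2.1 (q z.2).2.2
  have ha := hPm hf
  have hb := hPm hf.neg
  have hc := hPm hg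
  have hd := hPm hg.neg
  have heq : ∫ z : I × I, U z * f z.1 * g z.2 =
      (∫ z : I × I, U z * (P f z.1 : ℝ) * (P g z.2 : ℝ)) -
      (∫ z : I × I, U z * (P f z.1 : ℝ) * (P (-g) z.2 : ℝ)) -
      ((∫ z : I × I, U z * (P (-f) z.1 : ℝ) * (P g z.2 : ℝ)) -
      ∫ z : I × I, U z * (P (-f) z.1 : ℝ) * (P (-g) z.2 : ℝ)) := by
    rw [← integral_sub' (hint ha hc) (hint ha hd), ← integral_sub' (hint hb hc) (hint hb hd),
      ← integral_sub' ((hint ha hc).sub (hint ha hd)) ((hint hb hc).sub (hint hb hd))]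
    refine integral_congr_ae (ae_of_all _ fun z => ?_)
    simp only [Pi.sub_apply]
    rw [hsplit hf1 z.1, hsplit hg1 z.2]
    change _ = U z * (P f z.1 : ℝ) * (P g z.2 : ℝ) -
      U z * (P f z.1 : ℝ) * (P (fun x => -g x) z.2 : ℝ) -
      (U z * (P (fun x => -f x) z.1 : ℝ) * (P g z.2 : ℝ) -
      U z * (P (fun x => -f x) z.1 : ℝ) * (P (fun x => -g x) z.2 : ℝ))
    ring
  rw [heq]
  have h1 := abs_le.1 (abs_integral_le_cutNorm hU ha hc)
  have h2 := abs_le.1 (abs_integral_le_cutNorm hU ha hd)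
  have h3 := abs_le.1 (abs_integral_le_cutNorm hU hb hc)
  have h4 := abs_le.1 (abs_integral_le_cutNorm hU hb hd)
  rw [abs_le]
  constructor <;> linarith [h1.1, h1.2, h2.1, h2.2, h3.1, h3.2, h4.1, h4.2]

end CutNorm

/-! ### Multiplication operators -/

section Mul

theorem memLp_mul_bounded {m : I → ℝ} {C : ℝ} (hm : Measurable m) (hC : ∀ x, |m x| ≤ C) (f : L2) :
    MemLp (fun x => m x * f x) 2 :=
  (Lp.memLp f).of_le_mul (c := C) (hm.aestronglyMeasurable.mul (Lp.memLp f).1)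
    (ae_of_all _ fun x => by
      rw [norm_mul]
      exact mul_le_mul_of_nonneg_right (hC x) (norm_nonneg _))

/-- Multiplication by a bounded measurable function on `L²([0,1])`. -/
def mulOp {m : I → ℝ} {C : ℝ} (hm : Measurable m) (hC : ∀ x, |m x| ≤ C) : L2 →L[ℝ] L2 :=
  LinearMap.mkContinuous
    { toFun := fun f => (memLp_mul_bounded hm hC f).toLp _
      map_add' := fun f g => by
        rw [← MemLp.toLp_add, MemLp.toLp_eq_toLp_iff]
        filter_upwards [Lp.coeFn_add f g] with x hx
        rw [hx, Pi.add_apply, Pi.add_apply, mul_add]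
      map_smul' := fun c f => by
        rw [RingHom.id_apply, ← MemLp.toLp_const_smul, MemLp.toLp_eq_toLp_iff]
        filter_upwards [Lp.coeFn_smul c f] with x hx
        rw [hx, Pi.smul_apply, Pi.smul_apply, smul_eq_mul, smul_eq_mul, mul_left_comm] }
    C (fun f => by
      refine Lp.norm_le_mul_norm_of_ae_le_mul ?_
      filter_upwards [(memLp_mul_bounded hm hC f).coeFn_toLp] with x hx
      change ‖((memLp_mul_bounded hm hC f).toLp _ : L2) x‖ ≤ _
      rw [hx, norm_mul]
      exact mul_le_mul_of_nonneg_right (hC x) (norm_nonneg _))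

theorem mulOp_apply {m : I → ℝ} {C : ℝ} (hm : Measurable m) (hC : ∀ x, |m x| ≤ C) (f : L2) :
    mulOp hm hC f =ᵐ[volume] fun x => m x * f x :=
  (memLp_mul_bounded hm hC f).coeFn_toLp

theorem mulOp_mulOp {m r : I → ℝ} {C R : ℝ} (hm : Measurable m) (hC : ∀ x, |m x| ≤ C)
    (hr : Measurable r) (hR : ∀ x, |r x| ≤ R) (h : ∀ x, m x * r x = 1) (f : L2) :
    mulOp hm hC (mulOp hr hR f) = f := by
  refine Lp.ext ?_
  filter_upwards [mulOp_apply hm hC (mulOp hr hR f), mulOp_apply hr hR f] with x h1 h2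
  rw [h1, h2, ← mul_assoc, h, one_mul]

/-- Multiplication by a function bounded above and below, as an automorphism of `L²([0,1])`. -/
def mulEquiv {m r : I → ℝ} {C R : ℝ} (hm : Measurable m) (hC : ∀ x, |m x| ≤ C)
    (hr : Measurable r) (hR : ∀ x, |r x| ≤ R) (h : ∀ x, m x * r x = 1) : L2 ≃L[ℝ] L2 :=
  ContinuousLinearEquiv.equivOfInverse (mulOp hm hC) (mulOp hr hR)
    (mulOp_mulOp hr hR hm hC fun x => by rw [mul_comm, h x])
    (mulOp_mulOp hm hC hr hR h)

end Mul

/-! ### The symmetrized random walk kernel -/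

/-- The function `t ↦ 1 / √(max t ε)`. -/
def invSqrtMax (ε t : ℝ) : ℝ := (√(max t ε))⁻¹

section InvSqrtMax

variable {ε : ℝ}

theorem sqrt_max_pos (hε : 0 < ε) (t : ℝ) : 0 < √(max t ε) :=
  Real.sqrt_pos.2 (hε.trans_le (le_max_right _ _))

theorem invSqrtMax_pos (hε : 0 < ε) (t : ℝ) : 0 < invSqrtMax ε t := inv_pos.2 (sqrt_max_pos hε t)

theorem invSqrtMax_le (hε : 0 < ε) (t : ℝ) : invSqrtMax ε t ≤ (√ε)⁻¹ :=
  inv_anti₀ (Real.sqrt_pos.2 hε) (Real.sqrt_le_sqrt (le_max_right _ _))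

theorem abs_invSqrtMax_le (hε : 0 < ε) (t : ℝ) : |invSqrtMax ε t| ≤ (√ε)⁻¹ := by
  rw [abs_of_pos (invSqrtMax_pos hε t)]
  exact invSqrtMax_le hε t

theorem measurable_invSqrtMax (ε : ℝ) : Measurable (invSqrtMax ε) := by
  unfold invSqrtMax
  fun_prop

/-- Rationalizing, `1/p - 1/q = (q² - p²) / (p q (p + q))`: each of the three factors in the
denominator is at least `√ε`, and `t ↦ max t ε` is 1-Lipschitz. -/
theorem abs_invSqrtMax_sub_le (hε : 0 < ε) (a b : ℝ) :
    |invSqrtMax ε a - invSqrtMax ε b| ≤ (√ε)⁻¹ ^ 3 * |a - b| := by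
  set p := √(max a ε) with hp
  set q := √(max b ε) with hq
  have hp0 : 0 < p := sqrt_max_pos hε a
  have hq0 : 0 < q := sqrt_max_pos hε b
  have hpa : p⁻¹ ≤ (√ε)⁻¹ := invSqrtMax_le hε a
  have hqa : q⁻¹ ≤ (√ε)⁻¹ := invSqrtMax_le hε b
  have hR : 0 < (√ε)⁻¹ := inv_pos.2 (Real.sqrt_pos.2 hε)
  have hpq : (p + q)⁻¹ ≤ (√ε)⁻¹ := (inv_anti₀ hp0 (by linarith)).trans hpa
  have heq : p⁻¹ - q⁻¹ = p⁻¹ * q⁻¹ * (p + q)⁻¹ * (q ^ 2 - p ^ 2) := by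
    field_simp
    ring
  have hsq : |q ^ 2 - p ^ 2| ≤ |a - b| := by
    rw [hp, hq, Real.sq_sqrt (hε.le.trans (le_max_right _ _)),
      Real.sq_sqrt (hε.le.trans (le_max_right _ _)), abs_sub_comm a b]
    exact abs_max_sub_max_le_abs b a ε
  change |p⁻¹ - q⁻¹| ≤ _
  rw [heq, abs_mul, abs_of_pos (by positivity)]
  refine mul_le_mul ?_ hsq (abs_nonneg _) (by positivity)
  calc p⁻¹ * q⁻¹ * (p + q)⁻¹ ≤ (√ε)⁻¹ * (√ε)⁻¹ * (√ε)⁻¹ := by gcongr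
    _ = (√ε)⁻¹ ^ 3 := by ring

end InvSqrtMax

namespace Graphon

variable (W U : Graphon) {ε : ℝ}

theorem abs_toFun_le (z : I × I) : |W.toFun z| ≤ 1 := by
  rw [abs_of_nonneg (W.mem_Icc z).1]
  exact (W.mem_Icc z).2

theorem measurable_degree : Measurable W.degree :=
  (W.measurable_toFun.stronglyMeasurable.integral_prod_right' (ν := (volume : Measure I))).measurable

theorem degree_nonneg (x : I) : 0 ≤ W.degree x := integral_nonneg fun y => (W.mem_Icc (x, y)).1

theorem abs_degree_le (x : I) : |W.degree x| ≤ 1 := by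
  have h := norm_integral_le_of_norm_le_const (μ := (volume : Measure I)) (C := 1)
    (f := fun y => W.toFun (x, y)) (ae_of_all _ fun y => W.abs_toFun_le (x, y))
  simpa [degree] using h

/-- The symmetric kernel `W(x,y) / √(d(x) d(y))`, with the degrees bounded below by `ε`. -/
def symKernel (ε : ℝ) (z : I × I) : ℝ :=
  invSqrtMax ε (W.degree z.1) * W.toFun z * invSqrtMax ε (W.degree z.2)

theorem symKernel_symm (ε : ℝ) (x y : I) : W.symKernel ε (x, y) = W.symKernel ε (y, x) := by
  unfold symKernel
  rw [W.symm x y]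
  ring

theorem measurable_invSqrtMax_degree (ε : ℝ) : Measurable fun x => invSqrtMax ε (W.degree x) :=
  (measurable_invSqrtMax ε).comp W.measurable_degree

theorem measurable_symKernel (ε : ℝ) : Measurable (W.symKernel ε) :=
  (((W.measurable_invSqrtMax_degree ε).comp measurable_fst).mul W.measurable_toFun).mul
    ((W.measurable_invSqrtMax_degree ε).comp measurable_snd)

theorem abs_symKernel_le (hε : 0 < ε) (z : I × I) : |W.symKernel ε z| ≤ (√ε)⁻¹ * (√ε)⁻¹ := by
  unfold symKernel
  rw [abs_mul, abs_mul]
  have hR : 0 < (√ε)⁻¹ := inv_pos.2 (Real.sqrt_pos.2 hε)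
  refine mul_le_mul ?_ (abs_invSqrtMax_le hε _) (abs_nonneg _) hR.le
  exact (mul_le_of_le_one_right (abs_nonneg _) (W.abs_toFun_le z)).trans (abs_invSqrtMax_le hε _)

theorem memLp_symKernel (hε : 0 < ε) : MemLp (W.symKernel ε) 2 :=
  MemLp.of_bound (W.measurable_symKernel ε).aestronglyMeasurable _
    (ae_of_all _ (W.abs_symKernel_le hε))

theorem memLp_rwKernel (hε : 0 < ε) (hd : ∀ᵐ x, ε ≤ W.degree x) : MemLp W.rwKernel 2 := by
  have hm : Measurable W.rwKernel :=
    Measurable.ite (measurableSet_lt measurable_const (W.measurable_degree.comp measurable_fst))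
      (W.measurable_toFun.div (W.measurable_degree.comp measurable_fst)) measurable_const
  refine MemLp.of_bound hm.aestronglyMeasurable ε⁻¹ ?_
  have h : ∀ᵐ z : I × I, ε ≤ W.degree z.1 := by
    rw [Measure.volume_eq_prod]
    exact Measure.quasiMeasurePreserving_fst.ae hd
  filter_upwards [h] with z hz
  have hpos : 0 < W.degree z.1 := hε.trans_le hz
  unfold rwKernel
  rw [if_pos hpos, Real.norm_eq_abs, abs_div, abs_of_pos hpos, div_le_iff₀ hpos]
  refine (W.abs_toFun_le z).trans ?_
  rw [inv_mul_eq_div, one_le_div hε]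
  exact hz

/-- `M` is multiplication by `√(max d ε)`, equal to `√d` almost everywhere; the cutoff makes it
invertible at every point. -/
theorem exists_equiv_rwOp (hε : 0 < ε) (hd : ∀ᵐ x, ε ≤ W.degree x) (hW : MemLp W.rwKernel 2) :
    ∃ M : L2 ≃L[ℝ] L2, ∀ v, M (W.rwOp hW v) = kernelOp (W.memLp_symKernel hε) (M v) := by
  have hm : Measurable fun x => √(max (W.degree x) ε) :=
    (W.measurable_degree.max measurable_const).sqrt
  have hC (x : I) : |√(max (W.degree x) ε)| ≤ √(max 1 ε) := by
    rw [abs_of_nonneg (Real.sqrt_nonneg _)]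
    exact Real.sqrt_le_sqrt (max_le_max_right ε ((le_abs_self _).trans (W.abs_degree_le x)))
  have hr := W.measurable_invSqrtMax_degree ε
  have hmr (x : I) : √(max (W.degree x) ε) * invSqrtMax ε (W.degree x) = 1 :=
    mul_inv_cancel₀ (sqrt_max_pos hε _).ne'
  refine ⟨mulEquiv hm hC hr (fun x => abs_invSqrtMax_le hε _) hmr, fun v => ?_⟩
  change mulOp hm hC (kernelOp hW v) = kernelOp _ (mulOp hm hC v)
  refine Lp.ext ?_
  filter_upwards [mulOp_apply hm hC (kernelOp hW v), kernelOp_apply hW v,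
    kernelOp_apply (W.memLp_symKernel hε) (mulOp hm hC v), hd] with x h1 h2 h3 hx
  rw [h1, h2, h3, ← integral_const_mul]
  refine integral_congr_ae ?_
  filter_upwards [mulOp_apply hm hC v] with y hy
  have hpos : 0 < W.degree x := hε.trans_le hx
  have hsx : √(max (W.degree x) ε) * (W.toFun (x, y) / W.degree x) =
      invSqrtMax ε (W.degree x) * W.toFun (x, y) := by
    unfold invSqrtMax
    rw [max_eq_left hx]
    have h := Real.mul_self_sqrt hpos.le
    have h0 : √(W.degree x) ≠ 0 := (Real.sqrt_pos.2 hpos).ne'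
    rw [eq_inv_mul_iff_mul_eq₀ h0, ← mul_assoc, h, mul_div_cancel₀ _ hpos.ne']
  rw [hy]
  simp only [rwKernel, if_pos hpos, symKernel]
  rw [← mul_assoc, hsx]
  linear_combination (-(invSqrtMax ε (W.degree x) * W.toFun (x, y) * v y)) * hmr y

/-! ### Consequences of closeness in the cut norm -/

section Close

variable {φ : I → I}

/-- The difference `U - W^φ`. -/
def relabelDiff (φ : I → I) (z : I × I) : ℝ := U.toFun z - W.toFun (φ z.1, φ z.2)

theorem abs_relabelDiff_le (φ : I → I) (z : I × I) : |relabelDiff W U φ z| ≤ 1 := by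
  have h1 := U.mem_Icc z
  have h2 := W.mem_Icc (φ z.1, φ z.2)
  unfold relabelDiff
  rw [abs_le]
  constructor <;> linarith [h1.1, h1.2, h2.1, h2.2]

theorem measurable_relabelDiff (hφ : Measurable φ) : Measurable (relabelDiff W U φ) :=
  U.measurable_toFun.sub (W.measurable_toFun.comp
    ((hφ.comp measurable_fst).prodMk (hφ.comp measurable_snd)))

theorem integral_relabelDiff (hφ : MeasurePreserving φ volume volume) (x : I) :
    ∫ y, relabelDiff W U φ (x, y) = U.degree x - W.degree (φ x) := by
  have hWm : Measurable fun y => W.toFun (φ x, y) := W.measurable_toFun.comp measurable_prodMk_left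
  have hUm : Measurable fun y => U.toFun (x, y) := U.measurable_toFun.comp measurable_prodMk_left
  have h1 : ∫ y, W.toFun (φ x, φ y) = W.degree (φ x) := by
    have h := integral_map (μ := (volume : Measure I)) hφ.measurable.aemeasurable
      (f := fun y => W.toFun (φ x, y)) hWm.aestronglyMeasurable
    rw [hφ.map_eq] at h
    exact h.symm
  have hiU : Integrable fun y => U.toFun (x, y) :=
    Integrable.of_bound hUm.aestronglyMeasurable 1 (ae_of_all _ fun y => U.abs_toFun_le _)
  have hiW : Integrable fun y => W.toFun (φ x, φ y) :=
    Integrable.of_bound (hWm.comp hφ.measurable).aestronglyMeasurable 1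
      (ae_of_all _ fun y => W.abs_toFun_le _)
  rw [← h1]
  exact integral_sub hiU hiW

/-- Test `U - W^φ` against the sign of the degree difference in `x` and the constant `1` in `y`. -/
theorem integral_abs_degree_sub_le (hφ : MeasurePreserving φ volume volume) :
    ∫ x, |U.degree x - W.degree (φ x)| ≤ 4 * cutNorm (relabelDiff W U φ) := by
  have hdm : Measurable fun x => U.degree x - W.degree (φ x) :=
    U.measurable_degree.sub (W.measurable_degree.comp hφ.measurable)
  let s (x : I) : ℝ := if 0 ≤ U.degree x - W.degree (φ x) then 1 else -1
  have hs : Measurable s :=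
    Measurable.ite (measurableSet_le measurable_const hdm) measurable_const measurable_const
  have hs1 (x : I) : |s x| ≤ 1 := by
    simp only [s]
    split_ifs <;> simp
  have hDm := measurable_relabelDiff W U hφ.measurable
  have hint : Integrable (fun z : I × I => relabelDiff W U φ z * s z.1 * 1) := by
    refine Integrable.of_bound ((hDm.mul (hs.comp measurable_fst)).mul_const 1).aestronglyMeasurable
      1 (ae_of_all _ fun z => ?_)
    rw [mul_one, norm_mul]
    exact mul_le_one₀ (abs_relabelDiff_le W U φ z) (norm_nonneg _) (hs1 z.1)
  have h := abs_integral_le_four_mul_cutNorm hDm (abs_relabelDiff_le W U φ) (f := s)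
    (g := fun _ => 1) hs measurable_const hs1 (by simp)
  refine le_trans (le_of_eq ?_) ((le_abs_self _).trans h)
  rw [Measure.volume_eq_prod] at hint ⊢
  rw [integral_prod _ hint]
  refine integral_congr_ae (ae_of_all _ fun x => ?_)
  simp only [mul_one]
  rw [integral_mul_const, integral_relabelDiff W U hφ]
  simp only [s]
  split_ifs with h0
  · rw [abs_of_nonneg h0, mul_one]
  · rw [abs_of_neg (not_le.1 h0), mul_neg_one]

theorem integrable_abs_degree_sub (hφ : MeasurePreserving φ volume volume) :
    Integrable fun x => |U.degree x - W.degree (φ x)| := by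
  have hdm : Measurable fun x => U.degree x - W.degree (φ x) :=
    U.measurable_degree.sub (W.measurable_degree.comp hφ.measurable)
  refine (Integrable.of_bound hdm.aestronglyMeasurable 2 (ae_of_all _ fun x => ?_)).abs
  refine (abs_sub _ _).trans ?_
  linarith [U.abs_degree_le x, W.abs_degree_le (φ x)]

/-- A lower bound on degrees passes to cut distance limits. -/
theorem ae_le_degree_of_forall_cutNorm_lt (h : ∀ δ > 0, ∃ U : Graphon, (∀ᵐ x, ε ≤ U.degree x) ∧
    ∃ φ : I → I, MeasurePreserving φ volume volume ∧ cutNorm (relabelDiff W U φ) < δ) :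
    ∀ᵐ x, ε ≤ W.degree x := by
  have hgm : Measurable fun x => max (ε - W.degree x) 0 :=
    (measurable_const.sub W.measurable_degree).max measurable_const
  have hgi : Integrable fun x => max (ε - W.degree x) 0 := by
    refine Integrable.of_bound hgm.aestronglyMeasurable (max ε 0) (ae_of_all _ fun x => ?_)
    rw [Real.norm_eq_abs, abs_of_nonneg (le_max_right _ _)]
    exact max_le_max_right 0 (by linarith [W.degree_nonneg x])
  have hle : ∫ x, max (ε - W.degree x) 0 ≤ 0 := by
    refine le_of_forall_pos_le_add fun δ hδ => ?_
    obtain ⟨U, hU, φ, hφ, hc⟩ := h (δ / 4) (by positivity)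
    have hmap := integral_map (μ := (volume : Measure I)) hφ.measurable.aemeasurable
      (f := fun x => max (ε - W.degree x) 0) hgm.aestronglyMeasurable
    rw [hφ.map_eq] at hmap
    -- As `d_U ≥ ε`, the deficit of `W` below `ε` at `φ x` is at most the degree difference; its
    -- integral is unaffected by `φ`.
    have h1 : ∫ x, max (ε - W.degree (φ x)) 0 ≤ ∫ x, |U.degree x - W.degree (φ x)| := by
      refine integral_mono_ae ((hφ.integrable_comp hgm.aestronglyMeasurable).2 hgi)
        (integrable_abs_degree_sub W U hφ) ?_
      filter_upwards [hU] with x hx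
      exact max_le ((by linarith : _ ≤ U.degree x - W.degree (φ x)).trans (le_abs_self _))
        (abs_nonneg _)
    have h2 := integral_abs_degree_sub_le W U hφ
    rw [hmap]
    linarith
  have h0 : ∫ x, max (ε - W.degree x) 0 = 0 :=
    le_antisymm hle (integral_nonneg fun x => le_max_right _ _)
  have h0' := (integral_eq_zero_iff_of_nonneg (fun x => le_max_right _ _) hgi).1 h0
  filter_upwards [h0'] with x hx
  have hx' : max (ε - W.degree x) 0 = 0 := hx
  linarith [le_max_left (ε - W.degree x) 0]

end Close
end Graphon

/-! ### Continuity of the symmetrized operators in the cut distance -/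

namespace Graphon

variable (W U : Graphon) {ε : ℝ} {φ : I → I}

/-- Once `r (U - W^φ) r'` is removed, what remains is `W^φ (r r' - s s')`, which telescopes into
differences of inverse square roots of degrees. -/
theorem abs_symKernel_sub_decomp (hε : 0 < ε) (x y : I) :
    |(U.symKernel ε (x, y) - W.symKernel ε (φ x, φ y)) -
      invSqrtMax ε (U.degree x) * relabelDiff W U φ (x, y) * invSqrtMax ε (U.degree y)| ≤
    (√ε)⁻¹ ^ 4 * (|U.degree x - W.degree (φ x)| + |U.degree y - W.degree (φ y)|) := by
  set R := (√ε)⁻¹ with hR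
  have hR0 : 0 < R := inv_pos.2 (Real.sqrt_pos.2 hε)
  set r := invSqrtMax ε (U.degree x)
  set r' := invSqrtMax ε (U.degree y)
  set s := invSqrtMax ε (W.degree (φ x))
  set s' := invSqrtMax ε (W.degree (φ y))
  have h1 : |r - s| ≤ R ^ 3 * |U.degree x - W.degree (φ x)| := abs_invSqrtMax_sub_le hε _ _
  have h2 : |r' - s'| ≤ R ^ 3 * |U.degree y - W.degree (φ y)| := abs_invSqrtMax_sub_le hε _ _
  have hr : |r| ≤ R := abs_invSqrtMax_le hε _
  have hs : |s'| ≤ R := abs_invSqrtMax_le hε _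
  have heq : (U.symKernel ε (x, y) - W.symKernel ε (φ x, φ y)) - r * relabelDiff W U φ (x, y) * r' =
      W.toFun (φ x, φ y) * (r * (r' - s') + s' * (r - s)) := by
    simp only [symKernel, relabelDiff, r, s, r', s']
    ring
  rw [heq, abs_mul]
  calc _ ≤ 1 * (|r| * |r' - s'| + |s'| * |r - s|) := by
        refine mul_le_mul (W.abs_toFun_le _) ?_ (abs_nonneg _) zero_le_one
        rw [← abs_mul, ← abs_mul]
        exact abs_add_le _ _
    _ ≤ 1 * (R * (R ^ 3 * |U.degree y - W.degree (φ y)|) +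
        R * (R ^ 3 * |U.degree x - W.degree (φ x)|)) := by gcongr
    _ = _ := by ring

/-- In the main term the weights `r / R`, with `R = 1/√ε`, are absorbed into the test functions,
giving `4 R²` times the cut norm. The error contributes `R⁴` times two `L¹` degree differences, each
at most four times the cut norm. -/
theorem abs_integral_symKernel_sub_le (hε : 0 < ε) (hφ : MeasurePreserving φ volume volume)
    {f g : I → ℝ} (hf : Measurable f) (hg : Measurable g) (hf1 : ∀ x, |f x| ≤ 1)
    (hg1 : ∀ x, |g x| ≤ 1) :
    |∫ z : I × I, (U.symKernel ε z - W.symKernel ε (φ z.1, φ z.2)) * f z.2 * g z.1| ≤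
      (4 * (√ε)⁻¹ ^ 2 + 8 * (√ε)⁻¹ ^ 4) * cutNorm (relabelDiff W U φ) := by
  have hdec := abs_symKernel_sub_decomp W U (φ := φ) hε
  set R := (√ε)⁻¹
  have hR0 : 0 < R := inv_pos.2 (Real.sqrt_pos.2 hε)
  set c := cutNorm (relabelDiff W U φ)
  have hrm := U.measurable_invSqrtMax_degree ε
  have hDm := measurable_relabelDiff W U hφ.measurable
  let r (x : I) : ℝ := invSqrtMax ε (U.degree x)
  let E (x : I) : ℝ := |U.degree x - W.degree (φ x)|
  have hrR (x : I) : |r x| ≤ R := abs_invSqrtMax_le hε _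
  have hbound {u : I → ℝ} (hu : ∀ x, |u x| ≤ 1) (x : I) : |r x * u x / R| ≤ 1 := by
    rw [abs_div, abs_mul, abs_of_pos hR0, div_le_one hR0]
    exact (mul_le_of_le_one_right (abs_nonneg _) (hu x)).trans (hrR x)
  have hA := abs_integral_le_four_mul_cutNorm hDm (abs_relabelDiff_le W U φ)
    ((hrm.mul hg).div_const R) ((hrm.mul hf).div_const R) (hbound hg1) (hbound hf1)
  let A (z : I × I) : ℝ := R ^ 2 * (relabelDiff W U φ z * (r z.1 * g z.1 / R) *
    (r z.2 * f z.2 / R))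
  let D (z : I × I) : ℝ := U.symKernel ε z - W.symKernel ε (φ z.1, φ z.2)
  have hAm : Measurable A := by
    refine measurable_const.mul ((hDm.mul ?_).mul ?_)
    · exact ((hrm.mul hg).div_const R).comp measurable_fst
    · exact ((hrm.mul hf).div_const R).comp measurable_snd
  have hDKm : Measurable D := (U.measurable_symKernel ε).sub
    ((W.measurable_symKernel ε).comp
      ((hφ.measurable.comp measurable_fst).prodMk (hφ.measurable.comp measurable_snd)))
  have hAi : Integrable A := by
    refine Integrable.of_bound hAm.aestronglyMeasurable (R ^ 2) (ae_of_all _ fun z => ?_)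
    rw [Real.norm_eq_abs, abs_mul, abs_mul, abs_mul, abs_of_pos (by positivity)]
    refine mul_le_of_le_one_right (by positivity) ?_
    exact mul_le_one₀ (mul_le_one₀ (abs_relabelDiff_le W U φ z) (abs_nonneg _) (hbound hg1 z.1))
      (abs_nonneg _) (hbound hf1 z.2)
  have hDi : Integrable fun z : I × I => D z * f z.2 * g z.1 := by
    refine Integrable.of_bound
      ((hDKm.mul (hf.comp measurable_snd)).mul (hg.comp measurable_fst)).aestronglyMeasurable
      (R * R + R * R) (ae_of_all _ fun z => ?_)
    rw [Real.norm_eq_abs, abs_mul, abs_mul]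
    refine (mul_le_of_le_one_right (by positivity) (hg1 _)).trans
      ((mul_le_of_le_one_right (by positivity) (hf1 _)).trans ((abs_sub _ _).trans ?_))
    exact add_le_add (U.abs_symKernel_le hε z) (W.abs_symKernel_le hε _)
  have hEi : Integrable E := integrable_abs_degree_sub W U hφ
  have hE1 : Integrable fun z : I × I => E z.1 := hEi.comp_fst (volume : Measure I)
  have hE2 : Integrable fun z : I × I => E z.2 := hEi.comp_snd (volume : Measure I)
  have hEint : ∫ z : I × I, R ^ 4 * (E z.1 + E z.2) ≤ R ^ 4 * (8 * c) := by
    rw [integral_const_mul, integral_add hE1 hE2, Measure.volume_eq_prod,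
      integral_fun_fst, integral_fun_snd]
    simp only [probReal_univ, one_smul]
    have := integral_abs_degree_sub_le W U hφ
    refine mul_le_mul_of_nonneg_left ?_ (by positivity)
    change (∫ x, |U.degree x - W.degree (φ x)|) + (∫ x, |U.degree x - W.degree (φ x)|) ≤ 8 * c
    linarith
  have hdiff : |(∫ z, D z * f z.2 * g z.1) - ∫ z, A z| ≤ R ^ 4 * (8 * c) := by
    rw [← integral_sub hDi hAi]
    refine abs_integral_le_integral_abs.trans ((integral_mono (hDi.sub hAi).abs
      ((hE1.add hE2).const_mul (R ^ 4)) fun z => ?_).trans hEint)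
    have heq : D z * f z.2 * g z.1 - A z =
        (D z - r z.1 * relabelDiff W U φ z * r z.2) * f z.2 * g z.1 := by
      simp only [A]
      field_simp
    simp only [Pi.sub_apply, Pi.add_apply]
    rw [heq, abs_mul, abs_mul]
    refine (mul_le_of_le_one_right (by positivity) (hg1 _)).trans
      ((mul_le_of_le_one_right (by positivity) (hf1 _)).trans ?_)
    exact hdec z.1 z.2
  have hA' : |∫ z, A z| ≤ R ^ 2 * (4 * c) := by
    simp only [A]
    rw [integral_const_mul, abs_mul, abs_of_pos (by positivity : 0 < R ^ 2)]
    exact mul_le_mul_of_nonneg_left hA (by positivity)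
  change |∫ z, D z * f z.2 * g z.1| ≤ _
  have h1 := abs_sub_abs_le_abs_sub (∫ z, D z * f z.2 * g z.1) (∫ z, A z)
  linarith

/-- Graphons close in the cut norm have symmetrized random walk operators close in norm. -/
theorem exists_delta_norm_symKernel_sub_le (hε : 0 < ε) {η : ℝ} (hη : 0 < η) :
    ∃ δ > 0, ∀ (U W : Graphon) (φ : I → I) (hφ : MeasurePreserving φ volume volume),
      cutNorm (relabelDiff W U φ) < δ → ‖kernelOp (U.memLp_symKernel hε) -
        kernelOp (memLp_comp_prod (W.memLp_symKernel hε) hφ hφ)‖ ≤ η := by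
  have hR0 : 0 < (√ε)⁻¹ := inv_pos.2 (Real.sqrt_pos.2 hε)
  set R := (√ε)⁻¹ with hR
  obtain ⟨C, hCeq⟩ : ∃ C, C = 4 * R ^ 2 + 8 * R ^ 4 := ⟨_, rfl⟩
  have hC : 0 < C := by rw [hCeq]; positivity
  -- The kernel difference is bounded by `2 R²`; this `M` makes the truncation error `η / 2`, and
  -- `δ` is then chosen to make the main term `η / 2`.
  obtain ⟨M, hM⟩ : ∃ M, M = 8 * R ^ 2 / η := ⟨_, rfl⟩
  have hM0 : 0 < M := by rw [hM]; positivity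
  refine ⟨η / (2 * (M ^ 2 * C)), by positivity, fun U W φ hφ hc => ?_⟩
  rw [← kernelOp_sub]
  refine (norm_kernelOp_le_of_bounded _ (B := 2 * R ^ 2) (M := M)
    (δ := C * (η / (2 * (M ^ 2 * C)))) (fun z => ?_) hM0 fun f g hf hg hf1 hg1 => ?_).trans ?_
  · refine (abs_sub _ _).trans ?_
    have h1 := U.abs_symKernel_le hε z
    have h2 := W.abs_symKernel_le hε (φ z.1, φ z.2)
    rw [← hR] at h1 h2
    linarith
  · rw [hCeq]
    rw [hCeq] at hc
    exact (abs_integral_symKernel_sub_le W U hε hφ hf hg hf1 hg1).trans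
      (mul_le_mul_of_nonneg_left hc.le (by positivity))
  · have h1 : M ^ 2 * (C * (η / (2 * (M ^ 2 * C)))) = η / 2 := by field_simp
    have h2 : 2 * (2 * R ^ 2) / M = η / 2 := by
      rw [hM]
      field_simp
      norm_num
    rw [h1, h2, add_halves]

theorem exists_cutNorm_lt_of_cutDist_lt {δ : ℝ} (h : cutDist U W < δ) :
    ∃ φ : I → I, MeasurePreserving φ volume volume ∧ cutNorm (relabelDiff W U φ) < δ := by
  have : Nonempty {φ : I → I // MeasurePreserving φ volume volume} := ⟨⟨id, .id _⟩⟩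
  obtain ⟨φ, hφ⟩ := exists_lt_of_ciInf_lt h
  exact ⟨φ.1, φ.2, hφ⟩

/-- The symmetrized random walk operator, with degrees bounded below by `ε`. -/
def symOp (hε : 0 < ε) : L2 →L[ℝ] L2 := kernelOp (W.memLp_symKernel hε)

theorem isSpectralListing_rwOp (hε : 0 < ε) (hd : ∀ᵐ x, ε ≤ W.degree x)
    (hW : MemLp W.rwKernel 2) : IsSpectralListing (W.rwOp hW) 0 (posEigen (W.symOp hε))
      (fun i => -posEigen (-W.symOp hε) i) := by
  obtain ⟨M, hM⟩ := W.exists_equiv_rwOp hε hd hW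
  exact (isSpectralListing_posEigen (isSymmetric_kernelOp _ (W.symKernel_symm ε))
    (isCompactOperator_kernelOp _)).conj M hM

/-- The min-max values of the symmetrized random walk operators, and of their negatives, are
continuous in the cut distance. -/
theorem tendsto_posEigen_symOp {Wn : ℕ → Graphon}
    (hconv : Tendsto (fun n => cutDist (Wn n) W) atTop (𝓝 0)) (hε : 0 < ε) (i : ℕ) :
    Tendsto (fun n => posEigen ((Wn n).symOp hε) i) atTop (𝓝 (posEigen (W.symOp hε) i)) ∧
    Tendsto (fun n => posEigen (-(Wn n).symOp hε) i) atTop (𝓝 (posEigen (-W.symOp hε) i)) := by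
  have key : ∀ η > 0, ∀ᶠ n in atTop,
      |posEigen ((Wn n).symOp hε) i - posEigen (W.symOp hε) i| ≤ η ∧
      |posEigen (-(Wn n).symOp hε) i - posEigen (-W.symOp hε) i| ≤ η := by
    intro η hη
    obtain ⟨δ, hδ, h⟩ := exists_delta_norm_symKernel_sub_le hε hη
    filter_upwards [(tendsto_order.1 hconv).2 δ hδ] with n hn
    -- `φ` depends on `n`, which is harmless: the min-max values of the relabelled limit do not
    -- depend on it.
    obtain ⟨φ, hφ, hc⟩ := exists_cutNorm_lt_of_cutDist_lt W (Wn n) hn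
    have hm := memLp_comp_prod (W.memLp_symKernel hε) hφ hφ
    have hle := h (Wn n) W φ hφ hc
    have heq := kernelOp_comp_comp (W.memLp_symKernel hε) (W.symKernel_symm ε) hφ hm
    have h1 : posEigen (kernelOp hm) i = posEigen (W.symOp hε) i := by
      rw [heq]
      exact posEigen_conj_isometry _ _ i
    have h2 : posEigen (-kernelOp hm) i = posEigen (-W.symOp hε) i := by
      rw [heq, ← posEigen_conj_isometry (compIsometry hφ) (-W.symOp hε) i]
      congr 1
    rw [← h1, ← h2]
    refine ⟨(abs_posEigen_sub_le _ _ i).trans hle, (abs_posEigen_sub_le _ _ i).trans ?_⟩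
    rwa [neg_sub_neg, norm_sub_rev]
  constructor <;>
    refine Metric.tendsto_atTop'.2 fun η hη => ?_ <;>
    obtain ⟨N, hN⟩ := eventually_atTop.1 (key (η / 2) (half_pos hη)) <;>
    refine ⟨N, fun n hn => ?_⟩ <;>
    rw [Real.dist_eq]
  · exact (hN n hn.le).1.trans_lt (half_lt_self hη)
  · exact (hN n hn.le).2.trans_lt (half_lt_self hη)

end Graphon

end GraphonSpectra

end

theorem mainTheorem2 (Wn : ℕ → GraphonSpectra.Graphon) (W : GraphonSpectra.Graphon)
    (hconv : Tendsto (fun n => GraphonSpectra.cutDist (Wn n) W) atTop (𝓝 0))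
    (ε : ℝ) (hε : 0 < ε) (hdeg : ∀ n, ∀ᵐ x : I, ε < (Wn n).degree x) :
    ∃ (hWn : ∀ n, MemLp (Wn n).rwKernel 2) (hW : MemLp W.rwKernel 2),
      GraphonSpectra.SpectraConvergePointwise
        (fun n => (Wn n).rwOp (hWn n)) (W.rwOp hW) 0 ∧
      GraphonSpectra.SpectraConvergePointwise
        (fun n => (Wn n).rwLaplacian (hWn n)) (W.rwLaplacian hW) 1 := by
  have hdn (n : ℕ) : ∀ᵐ x : I, ε ≤ (Wn n).degree x := (hdeg n).mono fun x hx => hx.le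
  have hd : ∀ᵐ x : I, ε ≤ W.degree x := by
    refine W.ae_le_degree_of_forall_cutNorm_lt fun δ hδ => ?_
    obtain ⟨n, hn⟩ := ((tendsto_order.1 hconv).2 δ hδ).exists
    exact ⟨Wn n, hdn n, GraphonSpectra.Graphon.exists_cutNorm_lt_of_cutDist_lt W (Wn n) hn⟩
  have hWn (n : ℕ) := (Wn n).memLp_rwKernel hε (hdn n)
  have hW := W.memLp_rwKernel hε hd
  have hln (n : ℕ) := (Wn n).isSpectralListing_rwOp hε (hdn n) (hWn n)
  have hl := W.isSpectralListing_rwOp hε hd hW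
  have hlim (i : ℕ) := W.tendsto_posEigen_symOp hconv hε i
  refine ⟨hWn, hW, ⟨_, _, _, _, hln, hl, fun i => (hlim i).1, fun i => (hlim i).2.neg⟩,
    ⟨_, _, _, _, fun n => (hln n).id_sub, hl.id_sub, fun i => ?_, fun i => ?_⟩⟩
  -- Eigenvalues of the Laplacian above `1` come from negative eigenvalues of the random walk
  -- operator.
  · exact (hlim i).2.neg.const_sub 1
  · exact (hlim i).1.const_sub 1
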